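/- **Setting.** There are $K\ge 1$ transient nodes $[K]$ and one absorbing node $*$. A random walk moves from $i$ to $j\in[K]$ with probability $m_{ij}\ge 0$ and from $i$ to $*$ with probability $1-\sum_j m_{ij}$, where $\max_i\sum_j m_{ij}\le\rho<1$, $\rho>0$. Let $q_{ij}$ be the probability that a walk started at $i$ visits $j$, and assume $q_{ij}\ge\alpha>0$ for all $i\ne j$. In each epoch $t=1,\dots,T$ an adversary picks edge lengths $l^{(t)}_{ij},l^{(t)}_{i*}\in[0,1]$, possibly depending on the walks of the earlier epochs; the player draws a node $J_t$ from a distribution $(p_{t1},\dots,p_{tK})$ and observes a walk $\mathcal P_{t,J_t}$ run from $J_t$ until absorption. Let $l_{t,i}$ be the expected length of a walk started at $i$ with the edge lengths of epoch $t$. If $i\in\mathcal P_{t,J_t}$, let $Z_{t,i}$ be the length of $\mathcal P_{t,J_t}$ from its first visit to $i$ until absorption. Let $\hat q_{t,ij}$ be, among the epochs $s<t$ whose walk visited $i$, the fraction in which $j$ was visited after the first visit to $i$ (with $0/0=0$). With parameters $B,\beta,\eta\in\mathbb R$ and $\gamma\in[0,1]$ put $$\hat Z_{t,i}=\frac{\frac{Z_{t,i}-B}{B}\,\mathbb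 I[i\in\mathcal P_{t,J_t}]+\beta}{p_{ti}+\sum_{j\ne i}\hat q_{t,ji}\,p_{tj}},\qquad p_{ti}=(1-\gamma)\frac{\exp\big(\eta\sum_{s<t}\hat Z_{s,i}\big)}{\sum_{j}\exp\big(\eta\sum_{s<t}\hat Z_{s,j}\big)}+\frac{\gamma}{K}$$ ($\gamma=0$ is the plain exponential-weights player). **Statement.** For all $K$, $\rho$, $\alpha$ there are constants $c,C>0$ and $k\in\mathbb N$, depending only on $K,\rho,\alpha$, such that the following holds for all transition probabilities and adversaries as above, all integers $T\ge 1$, all $\varepsilon\in(0,1)$, all $\gamma\in[0,1]$, all $B$ with $\frac{KT\rho^{B}}{1-\rho}\le\varepsilon$, all $0<\beta\le c\sqrt{\log(T/\varepsilon)/T}$, all $\eta\ge0$ with $\eta\log(T/\varepsilon)\le c$, and every node $i\in[K]$: with probability at least $1-C\,\varepsilon\,(1+\log(T/\varepsilon))^{k}$ (that is, $1-\widetilde{\mathcal O}(\varepsilon)$), $$\beta\left(\sum_{t=1}^T\frac{l_{t,i}-B}{B}-\sum_{t=1}^T\hat Z_{t,i}\right)\le\log\frac{T}{\varepsilon^2}.$$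 -/

import Mathlib

open scoped ENNReal

noncomputable section

namespace RandomWalkBandit

/-- Transition probabilities among the `K` transient nodes. From node `i` the walk moves to the
absorbing node with the remaining probability `1 - ∑ j, m i j`. -/
structure Chain (K : ℕ) where
  m : Fin K → Fin K → ℝ
  nonneg : ∀ i j, 0 ≤ m i j
  row_lt_one : ∀ i, ∑ j, m i j < 1

/-- The list of transient nodes met by a walk before absorption, in order; the played node is the
first entry. -/
abbrev Walk (K : ℕ) := List (Fin K)

/-- The walks observed in the past epochs, most recent epoch first. -/
abbrev History (K : ℕ) := List (Walk K)

/-- Edge lengths in one epoch; `none` is the absorbing node. -/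
abbrev Lengths (K : ℕ) := Fin K → Option (Fin K) → ℝ

variable {K : ℕ}

/-- The probability that a walk now at `i` passes exactly through the nodes in the list and is then
absorbed. -/
def Chain.tailWeight (G : Chain K) : Fin K → List (Fin K) → ℝ≥0∞
  | i, [] => ENNReal.ofReal (1 - ∑ j, G.m i j)
  | i, j :: w => ENNReal.ofReal (G.m i j) * Chain.tailWeight G j w

theorem tsum_list_fin (f : List (Fin K) → ℝ≥0∞) :
    ∑' w, f w = f [] + ∑ j, ∑' w, f (j :: w) := by
  let e : Unit ⊕ (Fin K × List (Fin K)) ≃ List (Fin K) :=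
    { toFun := Sum.elim (fun _ => []) (fun p => p.1 :: p.2)
      invFun := fun w => match w with
        | [] => Sum.inl ()
        | j :: w => Sum.inr (j, w)
      left_inv := by rintro (_ | ⟨j, w⟩) <;> rfl
      right_inv := by rintro (_ | ⟨j, w⟩) <;> rfl }
  rw [← e.tsum_eq f, Summable.tsum_sum ENNReal.summable ENNReal.summable, tsum_fintype]
  change _ + ∑' p : Fin K × List (Fin K), f (p.1 :: p.2) = _
  rw [ENNReal.tsum_prod', tsum_fintype]
  simp [e]

theorem Chain.row_identity (G : Chain K) (i : Fin K) :
    ENNReal.ofReal (1 - ∑ j, G.m i j) + ∑ j, ENNReal.ofReal (G.m i j) = 1 := by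
  rw [← ENNReal.ofReal_sum_of_nonneg (fun j _ => G.nonneg i j),
    ← ENNReal.ofReal_add (by linarith [G.row_lt_one i])
      (Finset.sum_nonneg fun j _ => G.nonneg i j)]
  simp

theorem Chain.tsum_tailWeight_le (G : Chain K) (i : Fin K) :
    ∑' w, G.tailWeight i w ≤ 1 := by
  have key : ∀ (n : ℕ) (i : Fin K),
      ∑' w : List (Fin K), (if w.length < n then G.tailWeight i w else 0) ≤ 1 := by
    intro n
    induction n with
    | zero => intro i; simp
    | succ n ih =>
      intro i
      rw [tsum_list_fin, ← G.row_identity i]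
      refine add_le_add (by simp [Chain.tailWeight]) (Finset.sum_le_sum fun j _ => ?_)
      have : ∀ w : List (Fin K), (if (j :: w).length < n + 1 then G.tailWeight i (j :: w) else 0)
          = ENNReal.ofReal (G.m i j) * (if w.length < n then G.tailWeight j w else 0) := by
        intro w
        by_cases h : w.length < n <;> simp [Chain.tailWeight, h]
      simp_rw [this, ENNReal.tsum_mul_left]
      calc _ ≤ ENNReal.ofReal (G.m i j) * 1 := by gcongr; exact ih j
        _ = _ := mul_one _
  rw [ENNReal.tsum_eq_iSup_sum]
  refine iSup_le fun s => ?_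
  refine le_trans ?_ (key (s.sup List.length + 1) i)
  refine le_trans (Finset.sum_le_sum fun w hw => ?_) (ENNReal.sum_le_tsum s)
  rw [if_pos (Nat.lt_succ_of_le (Finset.le_sup (f := List.length) hw))]

theorem Chain.tsum_tailWeight (G : Chain K) (i : Fin K) : ∑' w, G.tailWeight i w = 1 := by
  have hfin : ∀ i, ∑' w, G.tailWeight i w ≠ ⊤ := fun i =>
    ne_top_of_le_ne_top ENNReal.one_ne_top (G.tsum_tailWeight_le i)
  have hrec : ∀ i, (∑' w, G.tailWeight i w).toReal
      = (1 - ∑ j, G.m i j) + ∑ j, G.m i j * (∑' w, G.tailWeight j w).toReal := by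
    intro i
    rw [tsum_list_fin]
    simp only [Chain.tailWeight, ENNReal.tsum_mul_left]
    rw [ENNReal.toReal_add ENNReal.ofReal_ne_top
      (ENNReal.sum_ne_top.2 fun j _ => ENNReal.mul_ne_top ENNReal.ofReal_ne_top (hfin j)),
      ENNReal.toReal_ofReal (by linarith [G.row_lt_one i]),
      ENNReal.toReal_sum fun j _ => ENNReal.mul_ne_top ENNReal.ofReal_ne_top (hfin j)]
    congr 1
    refine Finset.sum_congr rfl fun j _ => ?_
    rw [ENNReal.toReal_mul, ENNReal.toReal_ofReal (G.nonneg i j)]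
  obtain ⟨k, -, hk⟩ := Finset.exists_min_image Finset.univ
    (fun j => (∑' w, G.tailWeight j w).toReal) ⟨i, Finset.mem_univ i⟩
  have h1 : (∑' w, G.tailWeight i w).toReal ≤ 1 := by
    simpa using ENNReal.toReal_mono ENNReal.one_ne_top (G.tsum_tailWeight_le i)
  have h2 : 1 ≤ (∑' w, G.tailWeight k w).toReal := by
    have hs : (∑ j, G.m k j) * (∑' w, G.tailWeight k w).toReal
        ≤ ∑ j, G.m k j * (∑' w, G.tailWeight j w).toReal := by
      rw [Finset.sum_mul]
      exact Finset.sum_le_sum fun j hj => mul_le_mul_of_nonneg_left (hk j hj) (G.nonneg k j)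
    have hr := hrec k
    nlinarith [G.row_lt_one k]
  have h3 := hk i (Finset.mem_univ i)
  have h4 : (∑' w, G.tailWeight i w).toReal = 1 := le_antisymm h1 (h2.trans h3)
  rw [← ENNReal.ofReal_toReal (hfin i), h4, ENNReal.ofReal_one]

/-- The law of the walk started at `i` and run until absorption. -/
def Chain.walkFrom (G : Chain K) (i : Fin K) : PMF (Walk K) :=
  PMF.map (fun w => i :: w)
    ⟨G.tailWeight i, by
      have h := (ENNReal.summable (f := G.tailWeight i)).hasSum
      rwa [G.tsum_tailWeight i] at h⟩

/-- Probability of an event under a discrete law. -/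
def prob {Ω : Type*} (P : PMF Ω) (s : Set Ω) : ℝ := (P.toOuterMeasure s).toReal

/-- `q i j`: the probability that a walk started at `i` visits `j`. -/
def Chain.visitProb (G : Chain K) (i j : Fin K) : ℝ := prob (G.walkFrom i) {w | j ∈ w}

/-- Total length of a walk, the last edge to the absorbing node included. -/
def walkLength (len : Lengths K) : Walk K → ℝ
  | [] => 0
  | [x] => len x none
  | x :: y :: w => len x (some y) + walkLength len (y :: w)

/-- The part of a walk from its first visit to `i` on (empty if `i` is not visited). -/
def suffixFrom (i : Fin K) (w : Walk K) : Walk K := w.dropWhile (fun x => decide (x ≠ i))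

/-- `Z i`: the length of the walk from its first visit to `i` until absorption. -/
def hittingTime (len : Lengths K) (w : Walk K) (i : Fin K) : ℝ :=
  walkLength len (suffixFrom i w)

/-- `l i`: the expected length of a walk started at `i`, for fixed edge lengths. -/
def Chain.expHittingTime (G : Chain K) (len : Lengths K) (i : Fin K) : ℝ :=
  ∑' w : Walk K, (G.walkFrom i w).toReal * walkLength len w

/-- `N⁺ i`: the number of past epochs in which `i` was visited. -/
def visitCount (h : History K) (i : Fin K) : ℕ := h.countP (fun w => decide (i ∈ w))

/-- `q̂ i j`: among the past epochs that visited `i`, the fraction in which `j` was visited after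
the first visit to `i` (zero if there is no such epoch). -/
def qHat (h : History K) (i j : Fin K) : ℝ :=
  (h.countP (fun w => decide (j ∈ suffixFrom i w)) : ℝ) / (visitCount h i : ℝ)

/-- `p̂ i = p i + ∑_{j ≠ i} q̂ j i * p j`: the estimated probability that the epoch visits `i`. -/
def pHat (h : History K) (p : Fin K → ℝ) (i : Fin K) : ℝ :=
  p i + ∑ j ∈ Finset.univ.erase i, qHat h j i * p j

/-- Parameters of the player: shift `B`, bias `β`, learning rate `η`, uniform exploration `γ`. -/
structure Params where
  B : ℝ
  β : ℝ
  η : ℝ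
  γ : unitInterval

/-- The importance-weighted estimator `Ẑ i` of an epoch with past `h`, play distribution `p` and
observed walk `w`. -/
def estimator (θ : Params) (len : Lengths K) (h : History K) (p : Fin K → ℝ) (w : Walk K)
    (i : Fin K) : ℝ :=
  ((hittingTime len w i - θ.B) / θ.B * (if i ∈ w then 1 else 0) + θ.β) / pHat h p i

/-- Exponential weights for the cumulative scores `S`, mixed with the uniform distribution. -/
def expWeights (θ : Params) (S : Fin K → ℝ) (i : Fin K) : ℝ :=
  (1 - (θ.γ : ℝ)) * (Real.exp (θ.η * S i) / ∑ j, Real.exp (θ.η * S j)) + (θ.γ : ℝ) / K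

/-- The cumulative estimates after the past `h`. The edge lengths of each epoch are picked by the
adversary as a function of the past before that epoch. -/
def cumEstimate (θ : Params) (adv : History K → Lengths K) : History K → Fin K → ℝ
  | [] => fun _ => 0
  | w :: h => fun i => cumEstimate θ adv h i
      + estimator θ (adv h) h (expWeights θ (cumEstimate θ adv h)) w i

/-- `p_t`: the play distribution in the epoch with past `h`. -/
def playProb (θ : Params) (adv : History K → Lengths K) (h : History K) : Fin K → ℝ :=
  expWeights θ (cumEstimate θ adv h)

/-- `Ẑ_{t,i}` in the epoch with past `h` and observed walk `w`. -/
def zHat (θ : Params) (adv : History K → Lengths K) (h : History K) (w : Walk K) (i : Fin K) : ℝ :=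
  estimator θ (adv h) h (playProb θ adv h) w i

theorem expWeights_nonneg (θ : Params) (S : Fin K → ℝ) (i : Fin K) : 0 ≤ expWeights θ S i := by
  have h1 : (0 : ℝ) ≤ 1 - (θ.γ : ℝ) := by linarith [θ.γ.2.2]
  have h2 : (0 : ℝ) ≤ (θ.γ : ℝ) := θ.γ.2.1
  unfold expWeights
  positivity

theorem sum_expWeights [NeZero K] (θ : Params) (S : Fin K → ℝ) : ∑ i, expWeights θ S i = 1 := by
  have h1 : (∑ j, Real.exp (θ.η * S j)) ≠ 0 :=
    (Finset.sum_pos (fun j _ => Real.exp_pos _) Finset.univ_nonempty).ne'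
  have h2 : (K : ℝ) ≠ 0 := Nat.cast_ne_zero.2 (NeZero.ne K)
  unfold expWeights
  rw [Finset.sum_add_distrib, ← Finset.mul_sum, ← Finset.sum_div, div_self h1]
  simp only [Finset.sum_const, Finset.card_univ, Fintype.card_fin, nsmul_eq_mul]
  field_simp
  ring

/-- The law of the played node in the epoch with past `h`. -/
def playLaw [NeZero K] (θ : Params) (adv : History K → Lengths K) (h : History K) : PMF (Fin K) :=
  PMF.ofFintype (fun i => ENNReal.ofReal (playProb θ adv h i)) (by
    unfold playProb
    rw [← ENNReal.ofReal_sum_of_nonneg (fun i _ => expWeights_nonneg θ _ i)]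
    rw [sum_expWeights, ENNReal.ofReal_one])

/-- The law of the first `n` epochs: in each one a node is drawn from the play distribution and a
fresh walk is run from it until absorption. -/
def gameLaw [NeZero K] (G : Chain K) (θ : Params) (adv : History K → Lengths K) :
    ℕ → PMF (History K)
  | 0 => PMF.pure []
  | n + 1 => (gameLaw G θ adv n).bind fun h =>
      ((playLaw θ adv h).bind G.walkFrom).map (fun w => w :: h)

/-- `∑_t f_t` over the epochs of a history, where `f` receives the past and the walk of each
epoch. -/
def sumEpochs (f : History K → Walk K → ℝ) : History K → ℝ
  | [] => 0
  | w :: h => sumEpochs f h + f h w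

end RandomWalkBandit

end

/-!
With probability `1 - O(ε)` the cumulative estimate of every node is not much smaller than its
cumulative expected gain. Write `ℓ = log (T / ε)`, let `Y` be `(B - Z i) / B` on the event that the
walk visits `i` and zero otherwise (`visitedLoss`), let `v` be the true probability that the epoch
visits `i` (`Chain.visitMass`) and `P = pHat` its estimate. The strong Markov property at the first
visit to `i` (`Chain.strong_markov`) gives `E Y = v * (1 - l i / B)`, so, after dropping the
favourable bias `+β`, the regret of an epoch is at most

  `Y / P - (1 - l i / B) = (Y - E Y) / P + (1 - l i / B) * (v - P) / P`

(`loss_sub_zHat_le`), a martingale increment plus the relative error of `P`.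

* In the first `burnIn α * ℓ` epochs the constraint on `η` keeps all scores times `η` bounded
  (`abs_cumEstimate_le`; walks longer than `B` are unlikely by the choice of `B`). Every node is
  then played with probability at least `1 / (3 K)`, and an epoch costs `O(1)` (`early_epoch_le`).
* Afterwards every node has been visited in a positive fraction of the epochs, and the `qHat` are
  within `O(√(ℓ / t))` of the visiting probabilities (`abs_qHat_sub_le`, `gameLaw_frequency_le`). So
  `P ≥ α / 2`, and the relative error of `P` is `O(√(ℓ / t))` (`late_epoch_le`).

Both costs are `O(√(ℓ / (t + 1)))` in epoch `t`; multiplied by `β ≤ c √(ℓ / T)` they sum to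
`O(c ℓ)`. For the martingale part, `Y ≤ 1` and `Y` has bounded second moment, so
`exp (∑ (β / P) (Y - E Y) - O(β² T))` has expectation at most one
(`lmean_exp_compensatedLoss_le_one`), and the sum exceeds `log (1 / ε) + O(c² ℓ)` with
probability at most `ε`. For small `c` the total is at most `log (1 / ε) + ℓ = log (T / ε²)`
(`regret_le_of_concentration`). All concentration statements come from one Chernoff bound for sums
over epochs (`gameLaw_sumEpochs_ge`), with centred increments bounded through
`exp x ≤ 1 + x + x²` for `x ≤ 1` (`lmean_exp_le_one`).
-/

open scoped ENNReal

noncomputable section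

namespace RandomWalkBandit

variable {K : ℕ}

/-! ### Expectations under discrete laws -/

/-- Expectation of a nonnegative function under a discrete law. -/
def lmean {Ω : Type*} (P : PMF Ω) (F : Ω → ℝ≥0∞) : ℝ≥0∞ := ∑' w, P w * F w

/-- The real function `X` has a well-defined expectation under `P`, equal to `m`. -/
def HasMean {Ω : Type*} (P : PMF Ω) (X : Ω → ℝ) (m : ℝ) : Prop :=
  HasSum (fun w => (P w).toReal * X w) m

section Expectation

variable {Ω Ω' : Type*} {P : PMF Ω} {X Y U : Ω → ℝ} {x y u v : ℝ}

theorem lmean_mono {F F' : Ω → ℝ≥0∞} (h : ∀ w, F w ≤ F' w) : lmean P F ≤ lmean P F' :=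
  ENNReal.tsum_le_tsum fun w => by gcongr; exact h w

theorem lmean_const (P : PMF Ω) (c : ℝ≥0∞) : lmean P (fun _ => c) = c := by
  simp [lmean, ENNReal.tsum_mul_right, P.tsum_coe]

theorem lmean_const_mul (P : PMF Ω) (c : ℝ≥0∞) (F : Ω → ℝ≥0∞) :
    lmean P (fun w => c * F w) = c * lmean P F := by
  simp only [lmean, ← ENNReal.tsum_mul_left]
  exact tsum_congr fun w => by ring

theorem lmean_add (P : PMF Ω) (F F' : Ω → ℝ≥0∞) :
    lmean P (fun w => F w + F' w) = lmean P F + lmean P F' := by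
  simp only [lmean, mul_add, ENNReal.tsum_add]

theorem lmean_bind (P : PMF Ω) (f : Ω → PMF Ω') (F : Ω' → ℝ≥0∞) :
    lmean (P.bind f) F = lmean P fun a => lmean (f a) F := by
  simp only [lmean, PMF.bind_apply, ← ENNReal.tsum_mul_right, ← ENNReal.tsum_mul_left]
  rw [ENNReal.tsum_comm]
  exact tsum_congr fun a => tsum_congr fun w => by ring

theorem lmean_pure (a : Ω) (F : Ω → ℝ≥0∞) : lmean (PMF.pure a) F = F a := by
  classical
  rw [lmean, tsum_eq_single a]
  · simp
  · intro b hb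
    simp [PMF.pure_apply, hb]

theorem lmean_map (P : PMF Ω) (f : Ω → Ω') (F : Ω' → ℝ≥0∞) :
    lmean (P.map f) F = lmean P fun a => F (f a) := by
  rw [PMF.map, lmean_bind]
  simp only [Function.comp_apply, lmean_pure]

theorem toOuterMeasure_eq_lmean (P : PMF Ω) (s : Set Ω) :
    P.toOuterMeasure s = lmean P (s.indicator 1) := by
  rw [PMF.toOuterMeasure_apply, lmean]
  refine tsum_congr fun w => ?_
  by_cases h : w ∈ s <;> simp [h]

theorem HasMean.const (P : PMF Ω) (c : ℝ) : HasMean P (fun _ => c) c := by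
  have h : HasSum (fun w => (P w).toReal) 1 := by
    have h1 : (∑' w, P w) ≠ ⊤ := by simp [P.tsum_coe]
    have h2 := (ENNReal.summable_toReal h1).hasSum
    rwa [← ENNReal.tsum_toReal_eq (ENNReal.ne_top_of_tsum_ne_top h1), P.tsum_coe,
      ENNReal.toReal_one] at h2
  simpa [HasMean] using h.mul_right c

theorem HasMean.add (hX : HasMean P X x) (hY : HasMean P Y y) :
    HasMean P (fun w => X w + Y w) (x + y) := by
  simpa only [HasMean, mul_add] using HasSum.add hX hY

theorem HasMean.sub (hX : HasMean P X x) (hY : HasMean P Y y) :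
    HasMean P (fun w => X w - Y w) (x - y) := by
  simpa only [HasMean, mul_sub] using HasSum.sub hX hY

theorem HasMean.const_mul (hX : HasMean P X x) (c : ℝ) :
    HasMean P (fun w => c * X w) (c * x) := by
  simpa only [HasMean, mul_left_comm] using HasSum.mul_left c hX

theorem HasMean.bind {ι : Type*} [Fintype ι] (p : PMF ι) (f : ι → PMF Ω) {m : ι → ℝ}
    (h : ∀ i, HasMean (f i) X (m i)) :
    HasMean (p.bind f) X (∑ i, (p i).toReal * m i) := by
  have h1 : HasSum (fun w => ∑ i, (p i).toReal * ((f i w).toReal * X w))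
      (∑ i, (p i).toReal * m i) := hasSum_sum fun i _ => HasSum.mul_left _ (h i)
  refine h1.congr_fun ?_ |> fun h => h
  intro w
  rw [PMF.bind_apply, tsum_fintype, ENNReal.toReal_sum fun i _ =>
    ENNReal.mul_ne_top (p.apply_ne_top i) ((f i).apply_ne_top w), Finset.sum_mul]
  exact Finset.sum_congr rfl fun i _ => by rw [ENNReal.toReal_mul, mul_assoc]

/-- A nonnegative function with finite extended expectation has that expectation. -/
theorem hasMean_of_lmean_ne_top (h0 : ∀ w, 0 ≤ X w)
    (h : lmean P (fun w => ENNReal.ofReal (X w)) ≠ ⊤) :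
    HasMean P X (lmean P fun w => ENNReal.ofReal (X w)).toReal := by
  have h2 := (ENNReal.summable_toReal h).hasSum
  rw [← ENNReal.tsum_toReal_eq (ENNReal.ne_top_of_tsum_ne_top h)] at h2
  simpa [HasMean, lmean, ENNReal.toReal_mul, ENNReal.toReal_ofReal (h0 _)] using h2

theorem HasMean.lmean_ofReal (h0 : ∀ w, 0 ≤ X w) (h : HasMean P X x) :
    lmean P (fun w => ENNReal.ofReal (X w)) = ENNReal.ofReal x := by
  have h1 := ENNReal.ofReal_tsum_of_nonneg
    (fun w => mul_nonneg (ENNReal.toReal_nonneg (a := P w)) (h0 w)) (HasSum.summable h)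
  rw [HasSum.tsum_eq h] at h1
  rw [h1, lmean]
  refine tsum_congr fun w => ?_
  rw [ENNReal.ofReal_mul ENNReal.toReal_nonneg, ENNReal.ofReal_toReal (P.apply_ne_top w)]

/-- Exponential moment bound for a centred variable whose quadratic part `U` has expectation at
most `v`. -/
theorem lmean_exp_le_one (hX : HasMean P X 0) (hU : HasMean P U u)
    (hXU : ∀ w, Real.exp (X w) ≤ 1 + X w + U w) (huv : u ≤ v) :
    lmean P (fun w => ENNReal.ofReal (Real.exp (X w - v))) ≤ 1 := by
  have h1 : HasMean P (fun w => Real.exp (-v) * (1 + X w + U w)) (Real.exp (-v) * (1 + 0 + u)) :=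
    (((HasMean.const P 1).add hX).add hU).const_mul _
  have h2 : ∀ w, 0 ≤ Real.exp (-v) * (1 + X w + U w) := fun w =>
    mul_nonneg (Real.exp_pos _).le ((Real.exp_pos _).le.trans (hXU w))
  calc lmean P (fun w => ENNReal.ofReal (Real.exp (X w - v)))
      ≤ lmean P (fun w => ENNReal.ofReal (Real.exp (-v) * (1 + X w + U w))) := by
        refine lmean_mono fun w => ENNReal.ofReal_le_ofReal ?_
        rw [sub_eq_neg_add, Real.exp_add]
        exact mul_le_mul_of_nonneg_left (hXU w) (Real.exp_pos _).le
    _ = ENNReal.ofReal (Real.exp (-v) * (1 + 0 + u)) := h1.lmean_ofReal h2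
    _ ≤ 1 := by
        rw [ENNReal.ofReal_le_one]
        calc Real.exp (-v) * (1 + 0 + u) ≤ Real.exp (-v) * Real.exp v := by
              gcongr
              linarith [Real.add_one_le_exp v]
          _ = 1 := by rw [← Real.exp_add]; simp

end Expectation

theorem exp_le_one_add_add_sq {x : ℝ} (hx : x ≤ 1) : Real.exp x ≤ 1 + x + x ^ 2 := by
  rcases le_or_gt (-1) x with h | h
  · have := Real.abs_exp_sub_one_sub_id_le (abs_le.2 ⟨h, hx⟩)
    linarith [le_abs_self (Real.exp x - 1 - x)]
  · have : Real.exp x ≤ 1 := Real.exp_le_one_iff.2 (by linarith)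
    nlinarith

/-! ### The random walk: first steps, length, strong Markov property -/

theorem Chain.lmean_walkFrom (G : Chain K) (i : Fin K) (F : Walk K → ℝ≥0∞) :
    lmean (G.walkFrom i) F = ∑' w, G.tailWeight i w * F (i :: w) := by
  exact lmean_map _ _ F

/-- First-step analysis. -/
theorem Chain.lmean_first_step (G : Chain K) (i : Fin K) (F : Walk K → ℝ≥0∞) :
    lmean (G.walkFrom i) F = ENNReal.ofReal (1 - ∑ j, G.m i j) * F [i]
      + ∑ j, ENNReal.ofReal (G.m i j) * lmean (G.walkFrom j) (fun w => F (i :: w)) := by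
  simp only [G.lmean_walkFrom]
  rw [tsum_list_fin]
  simp only [Chain.tailWeight, mul_assoc, ENNReal.tsum_mul_left]

theorem Chain.sum_ofReal_mul_le (G : Chain K) {ρ : ℝ} (hρ : ∀ i, ∑ j, G.m i j ≤ ρ) (i : Fin K)
    {a : Fin K → ℝ≥0∞} {b : ℝ≥0∞} (h : ∀ j, a j ≤ b) :
    ∑ j, ENNReal.ofReal (G.m i j) * a j ≤ ENNReal.ofReal ρ * b := by
  calc ∑ j, ENNReal.ofReal (G.m i j) * a j ≤ ∑ j, ENNReal.ofReal (G.m i j) * b := by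
        gcongr with j; exact h j
    _ = ENNReal.ofReal (∑ j, G.m i j) * b := by
        rw [← Finset.sum_mul, ENNReal.ofReal_sum_of_nonneg fun j _ => G.nonneg i j]
    _ ≤ _ := by gcongr; exact hρ i

/-- Geometric tail of the number of steps until absorption. -/
theorem Chain.lmean_length_tail (G : Chain K) {ρ : ℝ} (hρ : ∀ i, ∑ j, G.m i j ≤ ρ) (n : ℕ)
    (i : Fin K) :
    lmean (G.walkFrom i) (fun w => if n < w.length then 1 else 0) ≤ ENNReal.ofReal ρ ^ n := by
  induction n generalizing i with
  | zero =>
    refine (lmean_mono (F' := fun _ => 1) fun w => ?_).trans ?_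
    · split_ifs <;> simp
    · simp [lmean_const]
  | succ n ih =>
    rw [G.lmean_first_step, pow_succ']
    simpa using G.sum_ofReal_mul_le hρ i ih

/-- A bound on the second moment of the length of a walk. It solves
`V = (1 + 1 / δ) + ρ (1 + δ) V` for `δ = (1 - ρ) / (2 * ρ)`. -/
def lengthSqBound (ρ : ℝ) : ℝ := 2 * (1 + ρ) / (1 - ρ) ^ 2

theorem lengthSqBound_nonneg {ρ : ℝ} (hρ0 : 0 < ρ) (hρ1 : ρ < 1) : 0 ≤ lengthSqBound ρ := by
  have : 0 < 1 - ρ := by linarith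
  rw [lengthSqBound]
  positivity

theorem Chain.lmean_length_sq_le (G : Chain K) {ρ : ℝ} (hρ0 : 0 < ρ) (hρ1 : ρ < 1)
    (hρ : ∀ i, ∑ j, G.m i j ≤ ρ) (i : Fin K) :
    lmean (G.walkFrom i) (fun w => ENNReal.ofReal ((w.length : ℝ) ^ 2))
      ≤ ENNReal.ofReal (lengthSqBound ρ) := by
  have hρ' : 0 < 1 - ρ := by linarith
  set δ := (1 - ρ) / (2 * ρ) with hδ
  have hδ0 : 0 < δ := by positivity
  have hδi : 1 / δ = 2 * ρ / (1 - ρ) := by rw [hδ]; field_simp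
  have hV0 := lengthSqBound_nonneg hρ0 hρ1
  have hV : 1 + 1 / δ + ρ * ((1 + δ) * lengthSqBound ρ) = lengthSqBound ρ := by
    rw [hδi, hδ, lengthSqBound]
    field_simp
    ring
  have key : ∀ (n : ℕ) (i : Fin K), lmean (G.walkFrom i)
      (fun w => if w.length < n then ENNReal.ofReal ((w.length : ℝ) ^ 2) else 0)
      ≤ ENNReal.ofReal (lengthSqBound ρ) := by
    intro n
    induction n with
    | zero => intro i; simp [lmean]
    | succ n ih =>
      intro i
      have hc : ∀ w : Walk K, (if (i :: w).length < n + 1 then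
            ENNReal.ofReal (((i :: w).length : ℝ) ^ 2) else 0)
          ≤ ENNReal.ofReal (1 + 1 / δ) + ENNReal.ofReal (1 + δ) *
            (if w.length < n then ENNReal.ofReal ((w.length : ℝ) ^ 2) else 0) := by
        intro w
        by_cases h : w.length < n
        · rw [if_pos h, if_pos (by simpa using h), ← ENNReal.ofReal_mul (by positivity),
            ← ENNReal.ofReal_add (by positivity) (by positivity)]
          refine ENNReal.ofReal_le_ofReal ?_
          have h3 : (1 + 1 / δ) + (1 + δ) * (w.length : ℝ) ^ 2 - ((w.length : ℝ) + 1) ^ 2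
              = (δ * w.length - 1) ^ 2 / δ := by field_simp; ring
          have h4 : 0 ≤ (δ * w.length - 1) ^ 2 / δ := by positivity
          simp only [List.length_cons, Nat.cast_add, Nat.cast_one]
          linarith
        · rw [if_neg (by simpa using h)]
          exact zero_le
      have h0 : ENNReal.ofReal (1 - ∑ j, G.m i j) *
          (if [i].length < n + 1 then ENNReal.ofReal (([i].length : ℝ) ^ 2) else 0)
          ≤ ENNReal.ofReal (1 - ∑ j, G.m i j) * ENNReal.ofReal (1 + 1 / δ) := by
        gcongr
        split_ifs
        · refine ENNReal.ofReal_le_ofReal ?_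
          have : 0 < 1 / δ := by positivity
          simp only [List.length_singleton, Nat.cast_one]
          linarith
        · exact zero_le
      rw [G.lmean_first_step]
      calc _ ≤ ENNReal.ofReal (1 - ∑ j, G.m i j) * ENNReal.ofReal (1 + 1 / δ)
            + ∑ j, ENNReal.ofReal (G.m i j) * (ENNReal.ofReal (1 + 1 / δ)
              + ENNReal.ofReal (1 + δ) * ENNReal.ofReal (lengthSqBound ρ)) := by
            refine add_le_add h0 (Finset.sum_le_sum fun j _ => ?_)
            gcongr
            refine (lmean_mono hc).trans ?_
            rw [lmean_add, lmean_const, lmean_const_mul]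
            gcongr
            exact ih j
        _ = ENNReal.ofReal (1 + 1 / δ) + ∑ j, ENNReal.ofReal (G.m i j) *
              (ENNReal.ofReal (1 + δ) * ENNReal.ofReal (lengthSqBound ρ)) := by
            simp only [mul_add, Finset.sum_add_distrib]
            rw [← add_assoc, ← Finset.sum_mul, ← add_mul, G.row_identity i, one_mul]
        _ ≤ ENNReal.ofReal (1 + 1 / δ) + ENNReal.ofReal ρ *
              (ENNReal.ofReal (1 + δ) * ENNReal.ofReal (lengthSqBound ρ)) := by
            gcongr
            exact G.sum_ofReal_mul_le hρ i fun j => le_rfl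
        _ = ENNReal.ofReal (lengthSqBound ρ) := by
            rw [← ENNReal.ofReal_mul (by positivity), ← ENNReal.ofReal_mul hρ0.le,
              ← ENNReal.ofReal_add (by positivity) (by positivity), hV]
  rw [lmean, ENNReal.tsum_eq_iSup_sum]
  refine iSup_le fun s => ?_
  refine le_trans ?_ (key (s.sup List.length + 1) i)
  refine le_trans (Finset.sum_le_sum fun w hw => ?_) (ENNReal.sum_le_tsum s)
  have h : w.length < s.sup List.length + 1 :=
    Nat.lt_succ_of_le (Finset.le_sup (f := List.length) hw)
  simp only [if_pos h, le_refl]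

theorem suffixFrom_cons_self (i : Fin K) (w : Walk K) : suffixFrom i (i :: w) = i :: w := by
  simp [suffixFrom]

theorem suffixFrom_cons_of_ne {i j : Fin K} (h : j ≠ i) (w : Walk K) :
    suffixFrom i (j :: w) = suffixFrom i w := by
  simp [suffixFrom, h]

theorem suffixFrom_nil (i : Fin K) : suffixFrom i [] = [] := rfl

theorem suffixFrom_of_not_mem {i : Fin K} {w : Walk K} (h : i ∉ w) : suffixFrom i w = [] := by
  rw [suffixFrom, List.dropWhile_eq_nil_iff]
  intro x hx
  simpa using fun hxi : x = i => h (hxi ▸ hx)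

theorem length_suffixFrom_le (i : Fin K) (w : Walk K) : (suffixFrom i w).length ≤ w.length :=
  (List.dropWhile_sublist _).length_le

theorem mem_of_mem_suffixFrom {i j : Fin K} {w : Walk K} (h : j ∈ suffixFrom i w) : i ∈ w := by
  by_contra h'
  simp [suffixFrom_of_not_mem h'] at h

/-- Solutions of `a j = ∑ k, m j k * a k` off a node are determined by their value there. -/
theorem Chain.harmonic_unique (G : Chain K) (i : Fin K) (d : Fin K → ℝ) (hi : d i = 0)
    (hd : ∀ j, j ≠ i → d j = ∑ k, G.m j k * d k) (j : Fin K) : d j = 0 := by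
  obtain ⟨k, -, hk⟩ := Finset.exists_max_image Finset.univ (fun j => |d j|) ⟨i, Finset.mem_univ i⟩
  have h0 : |d k| = 0 := by
    by_cases hki : k = i
    · simp [hki, hi]
    · have h1 : |d k| ≤ (∑ l, G.m k l) * |d k| := by
        calc |d k| = |∑ l, G.m k l * d l| := by rw [← hd k hki]
          _ ≤ ∑ l, |G.m k l * d l| := Finset.abs_sum_le_sum_abs _ _
          _ ≤ ∑ l, G.m k l * |d k| := by
            refine Finset.sum_le_sum fun l hl => ?_
            rw [abs_mul, abs_of_nonneg (G.nonneg k l)]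
            exact mul_le_mul_of_nonneg_left (hk l hl) (G.nonneg k l)
          _ = _ := by rw [Finset.sum_mul]
      nlinarith [G.row_lt_one k, abs_nonneg (d k)]
  have := hk j (Finset.mem_univ j)
  exact abs_eq_zero.1 (le_antisymm (this.trans h0.le) (abs_nonneg _))

theorem Chain.visitProb_nonneg (G : Chain K) (i j : Fin K) : 0 ≤ G.visitProb i j :=
  ENNReal.toReal_nonneg

theorem Chain.ofReal_visitProb (G : Chain K) (i j : Fin K) :
    lmean (G.walkFrom j) (fun w => ENNReal.ofReal (if i ∈ w then 1 else 0))
      = ENNReal.ofReal (G.visitProb j i) := by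
  have h1 : (G.walkFrom j).toOuterMeasure {w | i ∈ w} ≠ ⊤ := by
    refine ne_top_of_le_ne_top ENNReal.one_ne_top ?_
    rw [toOuterMeasure_eq_lmean]
    refine (lmean_mono (F' := fun _ => 1) fun w => ?_).trans (lmean_const _ _).le
    exact Set.indicator_le_self' (fun _ _ => zero_le) w
  rw [Chain.visitProb, prob, ENNReal.ofReal_toReal h1, toOuterMeasure_eq_lmean]
  congr 1
  ext w
  by_cases h : i ∈ w <;> simp [h]

theorem Chain.hasMean_visit (G : Chain K) (i j : Fin K) :
    HasMean (G.walkFrom j) (fun w => if i ∈ w then 1 else 0) (G.visitProb j i) := by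
  have h := hasMean_of_lmean_ne_top (P := G.walkFrom j) (X := fun w => if i ∈ w then 1 else 0)
    (fun w => by split_ifs <;> norm_num) (by rw [G.ofReal_visitProb]; exact ENNReal.ofReal_ne_top)
  rwa [G.ofReal_visitProb, ENNReal.toReal_ofReal (G.visitProb_nonneg j i)] at h

theorem Chain.visitProb_le_one (G : Chain K) (i j : Fin K) : G.visitProb i j ≤ 1 := by
  rw [← ENNReal.ofReal_le_one, ← G.ofReal_visitProb]
  refine (lmean_mono (F' := fun _ => 1) fun w => ?_).trans (lmean_const _ _).le
  split_ifs <;> simp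

theorem Chain.visitProb_self (G : Chain K) (i : Fin K) : G.visitProb i i = 1 := by
  have h := G.ofReal_visitProb i i
  have h2 : lmean (G.walkFrom i) (fun w => ENNReal.ofReal (if i ∈ w then 1 else 0)) = 1 := by
    rw [G.lmean_walkFrom]
    simpa using G.tsum_tailWeight i
  rw [h2] at h
  exact (ENNReal.ofReal_eq_one.1 h.symm)

/-- Strong Markov property at the first visit to `i`: conditionally on visiting `i`, the rest of
the walk is a walk started at `i`. Walks missing `i` do not count, as their suffix is empty. -/
theorem Chain.strong_markov (G : Chain K) (i : Fin K) (X : Walk K → ℝ) (hX : ∀ w, 0 ≤ X w)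
    (hnil : X [] = 0)
    (hfin : ∀ j, lmean (G.walkFrom j) (fun w => ENNReal.ofReal (X (suffixFrom i w))) ≠ ⊤)
    (j : Fin K) :
    HasMean (G.walkFrom j) (fun w => X (suffixFrom i w))
      (G.visitProb j i * (lmean (G.walkFrom i) fun w => ENNReal.ofReal (X w)).toReal) := by
  set a : Fin K → ℝ := fun j =>
    (lmean (G.walkFrom j) fun w => ENNReal.ofReal (X (suffixFrom i w))).toReal with ha
  set e := (lmean (G.walkFrom i) fun w => ENNReal.ofReal (X w)).toReal with he
  have hai : a i = e := by
    rw [ha, he]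
    simp only [G.lmean_walkFrom, suffixFrom_cons_self]
  have hrec : ∀ j, j ≠ i → a j = ∑ k, G.m j k * a k := by
    intro j hj
    have h := G.lmean_first_step j fun w => ENNReal.ofReal (X (suffixFrom i w))
    rw [suffixFrom_cons_of_ne hj] at h
    simp only [suffixFrom_cons_of_ne hj, suffixFrom_nil, hnil, ENNReal.ofReal_zero, mul_zero,
      zero_add] at h
    simp only [ha]
    rw [h, ENNReal.toReal_sum fun k _ => ENNReal.mul_ne_top ENNReal.ofReal_ne_top (hfin k)]
    exact Finset.sum_congr rfl fun k _ => by
      rw [ENNReal.toReal_mul, ENNReal.toReal_ofReal (G.nonneg j k)]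
  have hvrec : ∀ j, j ≠ i → G.visitProb j i = ∑ k, G.m j k * G.visitProb k i := by
    intro j hj
    have h := G.lmean_first_step j fun w => ENNReal.ofReal (if i ∈ w then 1 else 0)
    have h1 : ∀ w : Walk K, (i ∈ j :: w) ↔ i ∈ w := fun w => by simp [hj.symm]
    simp only [h1, List.not_mem_nil, if_false, ENNReal.ofReal_zero, mul_zero, zero_add,
      G.ofReal_visitProb] at h
    have h2 := congrArg ENNReal.toReal h
    rw [ENNReal.toReal_ofReal (G.visitProb_nonneg j i), ENNReal.toReal_sum fun k _ =>
      ENNReal.mul_ne_top ENNReal.ofReal_ne_top ENNReal.ofReal_ne_top] at h2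
    rw [h2]
    exact Finset.sum_congr rfl fun k _ => by
      rw [ENNReal.toReal_mul, ENNReal.toReal_ofReal (G.nonneg j k),
        ENNReal.toReal_ofReal (G.visitProb_nonneg k i)]
  have hzero := G.harmonic_unique i (fun j => a j - G.visitProb j i * e)
    (by simp [hai, G.visitProb_self]) (fun j hj => by
      rw [hrec j hj, hvrec j hj, Finset.sum_mul, ← Finset.sum_sub_distrib]
      exact Finset.sum_congr rfl fun k _ => by ring) j
  have hm := hasMean_of_lmean_ne_top (P := G.walkFrom j) (fun w => hX (suffixFrom i w)) (hfin j)
  rwa [show (lmean (G.walkFrom j) fun w => ENNReal.ofReal (X (suffixFrom i w))).toReal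
    = G.visitProb j i * e from sub_eq_zero.1 hzero] at hm

theorem Chain.hasMean_revisit (G : Chain K) (i k j : Fin K) :
    HasMean (G.walkFrom j) (fun w => if k ∈ suffixFrom i w then 1 else 0)
      (G.visitProb j i * G.visitProb i k) := by
  have h := G.strong_markov i (fun w => if k ∈ w then 1 else 0)
    (fun w => by split_ifs <;> norm_num) (by simp) (fun j => ?_) j
  · rwa [G.ofReal_visitProb, ENNReal.toReal_ofReal (G.visitProb_nonneg i k)] at h
  · refine ne_top_of_le_ne_top ENNReal.one_ne_top ?_
    refine (lmean_mono (F' := fun _ => 1) fun w => ?_).trans (lmean_const _ _).le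
    split_ifs <;> simp

theorem walkLength_bounds {len : Lengths K} (hlen : ∀ x y, 0 ≤ len x y ∧ len x y ≤ 1)
    (w : Walk K) : 0 ≤ walkLength len w ∧ walkLength len w ≤ w.length := by
  induction w with
  | nil => simp [walkLength]
  | cons x w ih =>
    cases w with
    | nil => simpa [walkLength] using hlen x none
    | cons y w =>
      have := hlen x (some y)
      simp only [walkLength, List.length_cons, Nat.cast_add, Nat.cast_one] at ih ⊢
      constructor <;> linarith

theorem hittingTime_bounds {len : Lengths K} (hlen : ∀ x y, 0 ≤ len x y ∧ len x y ≤ 1)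
    (w : Walk K) (i : Fin K) : 0 ≤ hittingTime len w i ∧ hittingTime len w i ≤ w.length :=
  ⟨(walkLength_bounds hlen _).1, (walkLength_bounds hlen _).2.trans
    (Nat.cast_le.2 (length_suffixFrom_le i w))⟩

theorem hittingTime_of_not_mem {len : Lengths K} {w : Walk K} {i : Fin K} (h : i ∉ w) :
    hittingTime len w i = 0 := by
  simp [hittingTime, suffixFrom_of_not_mem h, walkLength]

theorem natCast_le_sq (n : ℕ) : (n : ℝ) ≤ (n : ℝ) ^ 2 := by
  exact_mod_cast Nat.le_self_pow two_ne_zero n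

section Length

variable {ρ : ℝ} (G : Chain K) (hρ0 : 0 < ρ) (hρ1 : ρ < 1) (hρ : ∀ i, ∑ j, G.m i j ≤ ρ)
  {len : Lengths K} (hlen : ∀ x y, 0 ≤ len x y ∧ len x y ≤ 1)
include hρ0 hρ1 hρ

theorem Chain.exists_hasMean_length_sq (i : Fin K) :
    ∃ s ≤ lengthSqBound ρ, HasMean (G.walkFrom i) (fun w => (w.length : ℝ) ^ 2) s :=
  ⟨_, ENNReal.toReal_le_of_le_ofReal (lengthSqBound_nonneg hρ0 hρ1)
    (G.lmean_length_sq_le hρ0 hρ1 hρ i), hasMean_of_lmean_ne_top (fun _ => sq_nonneg _)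
    (ne_top_of_le_ne_top ENNReal.ofReal_ne_top (G.lmean_length_sq_le hρ0 hρ1 hρ i))⟩

include hlen

theorem Chain.lmean_walkLength_le (i : Fin K) (f : Walk K → Walk K)
    (hf : ∀ w, (f w).length ≤ w.length) :
    lmean (G.walkFrom i) (fun w => ENNReal.ofReal (walkLength len (f w)))
      ≤ ENNReal.ofReal (lengthSqBound ρ) := by
  refine (lmean_mono fun w => ENNReal.ofReal_le_ofReal ?_).trans
    (G.lmean_length_sq_le hρ0 hρ1 hρ i)
  exact ((walkLength_bounds hlen _).2.trans (Nat.cast_le.2 (hf w))).trans (natCast_le_sq _)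

theorem Chain.expHittingTime_eq (i : Fin K) :
    G.expHittingTime len i
      = (lmean (G.walkFrom i) fun w => ENNReal.ofReal (walkLength len w)).toReal :=
  (hasMean_of_lmean_ne_top (fun _ => (walkLength_bounds hlen _).1) (ne_top_of_le_ne_top
    ENNReal.ofReal_ne_top (G.lmean_walkLength_le hρ0 hρ1 hρ hlen i id fun _ => le_rfl))).tsum_eq

theorem Chain.expHittingTime_bounds (i : Fin K) :
    0 ≤ G.expHittingTime len i ∧ G.expHittingTime len i ≤ lengthSqBound ρ := by
  rw [G.expHittingTime_eq hρ0 hρ1 hρ hlen]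
  exact ⟨ENNReal.toReal_nonneg, ENNReal.toReal_le_of_le_ofReal (lengthSqBound_nonneg hρ0 hρ1)
    (G.lmean_walkLength_le hρ0 hρ1 hρ hlen i id fun _ => le_rfl)⟩

theorem Chain.hasMean_hittingTime (i j : Fin K) :
    HasMean (G.walkFrom j) (fun w => hittingTime len w i)
      (G.visitProb j i * G.expHittingTime len i) := by
  rw [G.expHittingTime_eq hρ0 hρ1 hρ hlen]
  exact G.strong_markov i (walkLength len) (fun w => (walkLength_bounds hlen w).1) rfl
    (fun j => ne_top_of_le_ne_top ENNReal.ofReal_ne_top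
      (G.lmean_walkLength_le hρ0 hρ1 hρ hlen j _ (length_suffixFrom_le i))) j

end Length

/-! ### Laws of epochs and exponential supermartingales -/

/-- The law of the walk observed in the epoch with past `h`. -/
def stepLaw [NeZero K] (G : Chain K) (θ : Params) (adv : History K → Lengths K) (h : History K) :
    PMF (Walk K) :=
  (playLaw θ adv h).bind G.walkFrom

/-- The probability that a walk started from the distribution `p` visits `i`. -/
def Chain.visitMass (G : Chain K) (p : Fin K → ℝ) (i : Fin K) : ℝ := ∑ j, p j * G.visitProb j i

/-- Minus the unweighted gain of the estimator: `(B - Z i) / B` if `i` is visited, else zero. -/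
def visitedLoss (θ : Params) (len : Lengths K) (w : Walk K) (i : Fin K) : ℝ :=
  (if i ∈ w then 1 else 0) - 1 / θ.B * hittingTime len w i

/-- The conditional expectation of `visitedLoss` given the past `h`. -/
def meanLoss (G : Chain K) (θ : Params) (adv : History K → Lengths K) (h : History K) (i : Fin K) :
    ℝ :=
  G.visitMass (playProb θ adv h) i * (1 - G.expHittingTime (adv h) i / θ.B)

/-- A bound on `1 + |meanLoss|` when `b ≤ B`. -/
def lossBound (ρ b : ℝ) : ℝ := 2 + lengthSqBound ρ / b

/-- A bound on the conditional variance of `visitedLoss` when `b ≤ B`. -/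
def lossVarBound (ρ b : ℝ) : ℝ := 2 * lossBound ρ b ^ 2 + 2 / b ^ 2 * lengthSqBound ρ

theorem playProb_nonneg (θ : Params) (adv : History K → Lengths K) (h : History K) (i : Fin K) :
    0 ≤ playProb θ adv h i := expWeights_nonneg θ _ i

section Game

variable [NeZero K] (G : Chain K) (θ : Params) (adv : History K → Lengths K)

theorem sum_playProb (h : History K) : ∑ i, playProb θ adv h i = 1 := sum_expWeights θ _

theorem hasMean_stepLaw (h : History K) {X : Walk K → ℝ} {m : Fin K → ℝ}
    (hX : ∀ j, HasMean (G.walkFrom j) X (m j)) :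
    HasMean (stepLaw G θ adv h) X (∑ j, playProb θ adv h j * m j) := by
  have h1 := HasMean.bind (playLaw θ adv h) G.walkFrom hX
  have h2 : ∀ j, (playLaw θ adv h j).toReal = playProb θ adv h j := fun j => by
    rw [playLaw, PMF.ofFintype_apply, ENNReal.toReal_ofReal (playProb_nonneg θ adv h j)]
  simpa only [h2, stepLaw] using h1

theorem lmean_stepLaw_le (h : History K) {F : Walk K → ℝ≥0∞} {b : ℝ≥0∞}
    (hF : ∀ j, lmean (G.walkFrom j) F ≤ b) : lmean (stepLaw G θ adv h) F ≤ b := by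
  rw [stepLaw, lmean_bind]
  exact (lmean_mono hF).trans (lmean_const _ _).le

theorem lmean_gameLaw_succ (n : ℕ) (F : History K → ℝ≥0∞) :
    lmean (gameLaw G θ adv (n + 1)) F
      = lmean (gameLaw G θ adv n) fun h => lmean (stepLaw G θ adv h) fun w => F (w :: h) := by
  rw [gameLaw, lmean_bind]
  simp only [lmean_map, stepLaw]

theorem lmean_exp_sumEpochs_le_one {f : History K → Walk K → ℝ}
    (hf : ∀ h, lmean (stepLaw G θ adv h) (fun w => ENNReal.ofReal (Real.exp (f h w))) ≤ 1)
    (n : ℕ) :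
    lmean (gameLaw G θ adv n) (fun h => ENNReal.ofReal (Real.exp (sumEpochs f h))) ≤ 1 := by
  induction n with
  | zero => simp [gameLaw, lmean_pure, sumEpochs]
  | succ n ih =>
    rw [lmean_gameLaw_succ]
    refine (lmean_mono fun h => ?_).trans ih
    simp only [sumEpochs, Real.exp_add, ENNReal.ofReal_mul (Real.exp_pos _).le, lmean_const_mul]
    calc _ ≤ ENNReal.ofReal (Real.exp (sumEpochs f h)) * 1 := by gcongr; exact hf h
      _ = _ := mul_one _

/-- Chernoff bound for the sum of the increments of an exponential supermartingale. -/
theorem gameLaw_sumEpochs_ge {f : History K → Walk K → ℝ}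
    (hf : ∀ h, lmean (stepLaw G θ adv h) (fun w => ENNReal.ofReal (Real.exp (f h w))) ≤ 1)
    (n : ℕ) (a : ℝ) :
    (gameLaw G θ adv n).toOuterMeasure {h | a ≤ sumEpochs f h}
      ≤ ENNReal.ofReal (Real.exp (-a)) := by
  rw [toOuterMeasure_eq_lmean]
  calc lmean (gameLaw G θ adv n) ({h | a ≤ sumEpochs f h}.indicator 1)
      ≤ lmean (gameLaw G θ adv n) (fun h => ENNReal.ofReal (Real.exp (-a)) *
          ENNReal.ofReal (Real.exp (sumEpochs f h))) := by
        refine lmean_mono fun h => ?_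
        by_cases hh : a ≤ sumEpochs f h
        · rw [Set.indicator_of_mem (by exact hh), ← ENNReal.ofReal_mul (Real.exp_pos _).le,
            ← Real.exp_add]
          exact ENNReal.one_le_ofReal.2 (Real.one_le_exp (by linarith))
        · rw [Set.indicator_of_notMem (by exact hh)]
          exact zero_le
    _ ≤ ENNReal.ofReal (Real.exp (-a)) * 1 := by
        rw [lmean_const_mul]
        gcongr
        exact lmean_exp_sumEpochs_le_one G θ adv hf n
    _ = _ := mul_one _

theorem gameLaw_length_ne (n : ℕ) :
    (gameLaw G θ adv n).toOuterMeasure {h | h.length ≠ n} = 0 := by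
  rw [toOuterMeasure_eq_lmean]
  induction n with
  | zero => simp [gameLaw, lmean_pure]
  | succ n ih =>
    rw [lmean_gameLaw_succ, ← ih]
    refine congrArg _ (funext fun h => ?_)
    rw [← lmean_const (stepLaw G θ adv h) (Set.indicator _ _ h)]
    refine congrArg _ (funext fun w => ?_)
    simp [Set.indicator]

/-- Union bound over the pasts of all epochs. -/
theorem gameLaw_exists_suffix_le {S : Set (History K)} {δ : ℝ≥0∞}
    (hS : ∀ n, (gameLaw G θ adv n).toOuterMeasure (S ∩ {h | h.length = n}) ≤ δ) (n : ℕ) :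
    (gameLaw G θ adv n).toOuterMeasure {ω | ∃ h, h <:+ ω ∧ h ∈ S} ≤ (n + 1) * δ := by
  have hS' : ∀ n, (gameLaw G θ adv n).toOuterMeasure S ≤ δ := fun n => by
    calc (gameLaw G θ adv n).toOuterMeasure S
        ≤ (gameLaw G θ adv n).toOuterMeasure (S ∩ {h | h.length = n} ∪ {h | h.length ≠ n}) := by
          refine MeasureTheory.measure_mono fun h hh => ?_
          by_cases h1 : h.length = n
          · exact Or.inl ⟨hh, h1⟩
          · exact Or.inr h1
      _ ≤ _ := MeasureTheory.measure_union_le _ _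
      _ ≤ δ := by rw [gameLaw_length_ne, add_zero]; exact hS n
  induction n with
  | zero =>
    simp only [Nat.cast_zero, zero_add, one_mul]
    refine le_trans ?_ (hS' 0)
    have h1 : [] ∈ {ω : History K | ∃ h, h <:+ ω ∧ h ∈ S} ↔ [] ∈ S := by simp
    simp only [gameLaw, toOuterMeasure_eq_lmean, lmean_pure]
    exact (Set.indicator_eq_indicator h1 rfl).le
  | succ n ih =>
    have h1 : (gameLaw G θ adv (n + 1)).toOuterMeasure {ω | ∃ h, h <:+ ω.tail ∧ h ∈ S}
        = (gameLaw G θ adv n).toOuterMeasure {ω | ∃ h, h <:+ ω ∧ h ∈ S} := by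
      rw [toOuterMeasure_eq_lmean, toOuterMeasure_eq_lmean, lmean_gameLaw_succ]
      refine congrArg _ (funext fun h => ?_)
      rw [← lmean_const (stepLaw G θ adv h) (Set.indicator _ _ h)]
      exact congrArg _ (funext fun w => Set.indicator_eq_indicator Iff.rfl rfl)
    calc _ ≤ (gameLaw G θ adv (n + 1)).toOuterMeasure
          ({ω | ∃ h, h <:+ ω.tail ∧ h ∈ S} ∪ S) := by
          refine MeasureTheory.measure_mono ?_
          rintro ω ⟨h, h1, h2⟩
          cases ω with
          | nil => exact Or.inl ⟨h, h1, h2⟩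
          | cons w ω =>
            rcases List.suffix_cons_iff.1 h1 with rfl | h1
            · exact Or.inr h2
            · exact Or.inl ⟨h, h1, h2⟩
      _ ≤ _ := MeasureTheory.measure_union_le _ _
      _ ≤ (n + 1) * δ + δ := by rw [h1]; exact add_le_add ih (hS' _)
      _ = _ := by push_cast; ring

theorem gameLaw_mem_long_le {ρ : ℝ} (hρ : ∀ i, ∑ j, G.m i j ≤ ρ) (b n : ℕ) :
    (gameLaw G θ adv n).toOuterMeasure {ω | ∃ w ∈ ω, b < w.length}
      ≤ (n + 1) * ENNReal.ofReal ρ ^ b := by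
  have h1 := gameLaw_exists_suffix_le G θ adv (S := {h | ∃ w g, h = w :: g ∧ b < w.length})
    (δ := ENNReal.ofReal ρ ^ b) (fun n => ?_) n
  · refine (MeasureTheory.measure_mono ?_).trans h1
    rintro ω ⟨w, hw, hb⟩
    obtain ⟨s, t, rfl⟩ := List.append_of_mem hw
    exact ⟨w :: t, List.suffix_append s _, w, t, rfl, hb⟩
  · refine (MeasureTheory.measure_mono Set.inter_subset_left).trans ?_
    rw [toOuterMeasure_eq_lmean]
    cases n with
    | zero => simp [gameLaw, lmean_pure]
    | succ n =>
      rw [lmean_gameLaw_succ]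
      refine (lmean_mono fun h => ?_).trans (lmean_const _ _).le
      refine lmean_stepLaw_le G θ adv h fun j => ?_
      refine le_trans (lmean_mono fun w => ?_) (G.lmean_length_tail hρ b j)
      simp [Set.indicator]

/-! ### Increments of the three exponential supermartingales -/

theorem hasMean_stepLaw_visit (h : History K) (i : Fin K) :
    HasMean (stepLaw G θ adv h) (fun w => if i ∈ w then 1 else 0)
      (G.visitMass (playProb θ adv h) i) :=
  hasMean_stepLaw G θ adv h fun j => G.hasMean_visit i j

theorem visitMass_ge {a : ℝ} (ha : ∀ i j, a ≤ G.visitProb i j) (h : History K) (i : Fin K) :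
    a ≤ G.visitMass (playProb θ adv h) i := by
  calc a = ∑ j, playProb θ adv h j * a := by rw [← Finset.sum_mul, sum_playProb, one_mul]
    _ ≤ _ := Finset.sum_le_sum fun j _ =>
      mul_le_mul_of_nonneg_left (ha j i) (playProb_nonneg θ adv h j)

theorem visitMass_mem (h : History K) (i : Fin K) :
    0 ≤ G.visitMass (playProb θ adv h) i ∧ G.visitMass (playProb θ adv h) i ≤ 1 := by
  refine ⟨visitMass_ge G θ adv (fun i j => G.visitProb_nonneg i j) h i, ?_⟩
  calc _ ≤ ∑ j, playProb θ adv h j * 1 := Finset.sum_le_sum fun j _ =>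
        mul_le_mul_of_nonneg_left (G.visitProb_le_one j i) (playProb_nonneg θ adv h j)
    _ = 1 := by rw [← Finset.sum_mul, sum_playProb, one_mul]

/-- Increment controlling the number of visits to `i` from below. -/
theorem lmean_exp_visit_le_one {a : ℝ} (ha : ∀ i j, a ≤ G.visitProb i j) (i : Fin K)
    (h : History K) :
    lmean (stepLaw G θ adv h)
      (fun w => ENNReal.ofReal (Real.exp (a / 4 - 1 / 2 * if i ∈ w then 1 else 0))) ≤ 1 := by
  set v := G.visitMass (playProb θ adv h) i with hv
  have hav : a ≤ v := visitMass_ge G θ adv ha h i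
  obtain ⟨hv0, hv1⟩ := visitMass_mem G θ adv h i
  have hm := hasMean_stepLaw_visit G θ adv h i
  rw [← hv] at hm hv0 hv1
  have hX : HasMean (stepLaw G θ adv h) (fun w => v / 2 - 1 / 2 * if i ∈ w then 1 else 0) 0 := by
    convert (HasMean.const _ (v / 2)).sub (hm.const_mul (1 / 2)) using 1
    ring
  have hU := (HasMean.const (stepLaw G θ adv h) (v ^ 2 / 4)).add (hm.const_mul ((1 - 2 * v) / 4))
  refine le_trans (lmean_mono fun w => ENNReal.ofReal_le_ofReal (Real.exp_le_exp.2 ?_))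
    (lmean_exp_le_one hX hU (v := v / 4) (fun w => ?_) (by nlinarith))
  · linarith
  · refine (exp_le_one_add_add_sq ?_).trans (le_of_eq ?_)
    · split_ifs <;> linarith
    · split_ifs <;> ring

/-- Increment controlling the fluctuations of the empirical frequencies `qHat`. -/
theorem lmean_exp_revisit_le_one {s : ℝ} (hs : |s| ≤ 1) (i j : Fin K) (h : History K) :
    lmean (stepLaw G θ adv h) (fun w => ENNReal.ofReal (Real.exp
      (s * ((if i ∈ suffixFrom j w then 1 else 0) - G.visitProb j i * if j ∈ w then 1 else 0)
        - s ^ 2))) ≤ 1 := by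
  have hm : HasMean (stepLaw G θ adv h)
      (fun w => (if i ∈ suffixFrom j w then 1 else 0) - G.visitProb j i * if j ∈ w then 1 else 0)
      0 := by
    have := hasMean_stepLaw G θ adv h fun k =>
      (G.hasMean_revisit j i k).sub ((G.hasMean_visit j k).const_mul (G.visitProb j i))
    convert this using 1
    exact (Finset.sum_eq_zero fun k _ => by ring).symm
  have hX := hm.const_mul s
  rw [mul_zero] at hX
  refine lmean_exp_le_one hX (HasMean.const _ (s ^ 2)) (fun w => ?_) le_rfl
  have hq0 := G.visitProb_nonneg j i
  have hq1 := G.visitProb_le_one j i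
  set x : ℝ := (if i ∈ suffixFrom j w then 1 else 0) - G.visitProb j i * if j ∈ w then 1 else 0
    with hx
  have hx1 : |x| ≤ 1 := by
    rw [hx, abs_le]
    by_cases h1 : i ∈ suffixFrom j w
    · simp only [h1, mem_of_mem_suffixFrom h1, if_true]
      constructor <;> linarith
    · simp only [h1, if_false]
      split_ifs <;> constructor <;> linarith
  have h1 : s * x ≤ 1 := (le_abs_self _).trans (by
    rw [abs_mul]; exact mul_le_one₀ hs (abs_nonneg _) hx1)
  have h2 : x ^ 2 ≤ 1 := by rw [← sq_abs]; exact pow_le_one₀ (abs_nonneg _) hx1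
  nlinarith [exp_le_one_add_add_sq h1, mul_le_mul_of_nonneg_left h2 (sq_nonneg s)]

variable {ρ b : ℝ} (hρ0 : 0 < ρ) (hρ1 : ρ < 1) (hρ : ∀ i, ∑ j, G.m i j ≤ ρ) (hb : 0 < b)
  (hbB : b ≤ θ.B) (hadv : ∀ h x y, 0 ≤ adv h x y ∧ adv h x y ≤ 1)
include hρ0 hρ1 hρ hb hbB hadv

omit [NeZero K] in
theorem one_sub_div_bounds (h : History K) (i : Fin K) :
    |1 - G.expHittingTime (adv h) i / θ.B| ≤ lossBound ρ b - 1 := by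
  obtain ⟨h0, h1⟩ := G.expHittingTime_bounds hρ0 hρ1 hρ (hadv h) i
  have hB : 0 < θ.B := hb.trans_le hbB
  have h2 : 0 ≤ G.expHittingTime (adv h) i / θ.B := div_nonneg h0 hB.le
  have h3 : G.expHittingTime (adv h) i / θ.B ≤ lengthSqBound ρ / b :=
    div_le_div₀ (lengthSqBound_nonneg hρ0 hρ1) h1 hb hbB
  rw [lossBound, abs_le]
  constructor <;> linarith

theorem abs_meanLoss_le (h : History K) (i : Fin K) :
    |meanLoss G θ adv h i| ≤ lossBound ρ b - 1 := by
  have h1 := one_sub_div_bounds G θ adv hρ0 hρ1 hρ hb hbB hadv h i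
  obtain ⟨hv0, hv1⟩ := visitMass_mem G θ adv h i
  rw [meanLoss, abs_mul, abs_of_nonneg hv0]
  exact (mul_le_of_le_one_left (abs_nonneg _) hv1).trans h1

/-- Increment controlling the importance-weighted estimates. The loss is at most `1` but not
bounded below, so only its second moment enters. -/
theorem lmean_exp_loss_le_one {s : ℝ} (hs0 : 0 ≤ s) (hs1 : s * lossBound ρ b ≤ 1) (i : Fin K)
    (h : History K) :
    lmean (stepLaw G θ adv h) (fun w => ENNReal.ofReal (Real.exp
      (s * (visitedLoss θ (adv h) w i - meanLoss G θ adv h i)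
        - s ^ 2 * lossVarBound ρ b))) ≤ 1 := by
  have hB : 0 < θ.B := hb.trans_le hbB
  have hL := abs_meanLoss_le G θ adv hρ0 hρ1 hρ hb hbB hadv h i
  have hm : HasMean (stepLaw G θ adv h) (fun w => visitedLoss θ (adv h) w i)
      (meanLoss G θ adv h i) := by
    have := hasMean_stepLaw G θ adv h fun k => (G.hasMean_visit i k).sub
      ((G.hasMean_hittingTime hρ0 hρ1 hρ (hadv h) i k).const_mul (1 / θ.B))
    have e : meanLoss G θ adv h i = ∑ j, playProb θ adv h j * (G.visitProb j i
        - 1 / θ.B * (G.visitProb j i * G.expHittingTime (adv h) i)) := by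
      rw [meanLoss, Chain.visitMass, Finset.sum_mul]
      exact Finset.sum_congr rfl fun k _ => by ring
    rw [e]
    exact this
  have hX : HasMean (stepLaw G θ adv h)
      (fun w => s * (visitedLoss θ (adv h) w i - meanLoss G θ adv h i)) 0 := by
    simpa using (hm.sub (HasMean.const _ (meanLoss G θ adv h i))).const_mul s
  choose m hm1 hm2 using G.exists_hasMean_length_sq hρ0 hρ1 hρ
  have hlen := hasMean_stepLaw G θ adv h hm2
  have hlen1 : ∑ j, playProb θ adv h j * m j ≤ lengthSqBound ρ := by
    calc _ ≤ ∑ j, playProb θ adv h j * lengthSqBound ρ := Finset.sum_le_sum fun j _ =>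
          mul_le_mul_of_nonneg_left (hm1 j) (playProb_nonneg θ adv h j)
      _ = _ := by rw [← Finset.sum_mul, sum_playProb, one_mul]
  have hU := ((HasMean.const (stepLaw G θ adv h) (2 * lossBound ρ b ^ 2)).add
    (hlen.const_mul (2 / b ^ 2))).const_mul (s ^ 2)
  refine lmean_exp_le_one hX hU (fun w => ?_) ?_
  · set y := visitedLoss θ (adv h) w i - meanLoss G θ adv h i with hy
    obtain ⟨hZ0, hZ1⟩ := hittingTime_bounds (hadv h) w i
    have hZ2 : 1 / θ.B * hittingTime (adv h) w i ≤ w.length / b := by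
      rw [one_div_mul_eq_div]; gcongr
    have hZ3 : 0 ≤ 1 / θ.B * hittingTime (adv h) w i := by positivity
    obtain ⟨hL1, hL2⟩ := abs_le.1 hL
    have hy1 : y ≤ lossBound ρ b := by
      rw [hy, visitedLoss]; split_ifs <;> linarith
    have hy2 : -(lossBound ρ b + w.length / b) ≤ y := by
      rw [hy, visitedLoss]; split_ifs <;> linarith
    have hlb : 0 ≤ (w.length : ℝ) / b := by positivity
    have hy3 : y ^ 2 ≤ 2 * lossBound ρ b ^ 2 + 2 / b ^ 2 * (w.length : ℝ) ^ 2 := by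
      have h4 : y ^ 2 ≤ (lossBound ρ b + w.length / b) ^ 2 :=
        sq_le_sq' hy2 (by linarith)
      have h5 : 2 / b ^ 2 * (w.length : ℝ) ^ 2 = 2 * (w.length / b) ^ 2 := by
        rw [div_pow]; ring
      rw [h5]
      nlinarith [sq_nonneg (lossBound ρ b - w.length / b)]
    have h6 : s * y ≤ 1 := (mul_le_mul_of_nonneg_left hy1 hs0).trans hs1
    have h7 := mul_le_mul_of_nonneg_left hy3 (sq_nonneg s)
    nlinarith [exp_le_one_add_add_sq h6]
  · rw [lossVarBound]
    gcongr

end Game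

/-! ### Sums over epochs -/

theorem sumEpochs_mul_sub (a : ℝ) (f g : History K → Walk K → ℝ) (ω : History K) :
    a * (sumEpochs f ω - sumEpochs g ω) = sumEpochs (fun h w => a * (f h w - g h w)) ω := by
  induction ω with
  | nil => simp [sumEpochs]
  | cons w h ih => simp only [sumEpochs, ← ih]; ring

theorem sumEpochs_le_add_sum {f g : History K → Walk K → ℝ} {r : ℕ → ℝ} {ω : History K}
    (H : ∀ h w, (w :: h) <:+ ω → f h w ≤ g h w + r h.length) :
    sumEpochs f ω ≤ sumEpochs g ω + ∑ t ∈ Finset.range ω.length, r t := by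
  induction ω with
  | nil => simp [sumEpochs]
  | cons w h ih =>
    have h1 := ih fun g v hg => H g v (hg.trans (List.suffix_cons w h))
    have h2 := H h w List.suffix_rfl
    simp only [sumEpochs, List.length_cons, Finset.sum_range_succ]
    linarith

theorem sumEpochs_visit (a : ℝ) (j : Fin K) (h : History K) :
    sumEpochs (fun _ w => a - 1 / 2 * if j ∈ w then 1 else 0) h
      = h.length * a - visitCount h j / 2 := by
  induction h with
  | nil => simp [sumEpochs, visitCount]
  | cons w h ih =>
    simp only [sumEpochs, ih, visitCount, List.countP_cons, List.length_cons, decide_eq_true_eq]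
    split_ifs <;> push_cast <;> ring

theorem sumEpochs_revisit (s q : ℝ) (i j : Fin K) (h : History K) :
    sumEpochs (fun _ w => s * ((if i ∈ suffixFrom j w then 1 else 0) - q * if j ∈ w then 1 else 0)
        - s ^ 2) h
      = s * (h.countP (fun w => decide (i ∈ suffixFrom j w)) - q * visitCount h j)
        - h.length * s ^ 2 := by
  induction h with
  | nil => simp [sumEpochs, visitCount]
  | cons w h ih =>
    simp only [sumEpochs, ih, visitCount, List.countP_cons, List.length_cons, decide_eq_true_eq]
    split_ifs <;> push_cast <;> ring

theorem sum_inv_sqrt_le (T : ℕ) :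
    ∑ t ∈ Finset.range T, 1 / Real.sqrt ((t : ℝ) + 1) ≤ 2 * Real.sqrt T := by
  induction T with
  | zero => simp
  | succ n ih =>
    rw [Finset.sum_range_succ]
    push_cast
    set x := Real.sqrt n
    set y := Real.sqrt ((n : ℝ) + 1) with hy
    have hy0 : 0 < y := Real.sqrt_pos.2 (by positivity)
    have hx2 : x ^ 2 = n := Real.sq_sqrt (by positivity)
    have hy2 : y ^ 2 = n + 1 := Real.sq_sqrt (by positivity)
    have h1 : 1 / y ≤ 2 * (y - x) := by
      rw [div_le_iff₀ hy0]
      nlinarith [sq_nonneg (y - x)]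
    linarith

/-! ### The play distribution and the estimator -/

theorem qHat_nonneg (h : History K) (i j : Fin K) : 0 ≤ qHat h i j := by
  unfold qHat; positivity

theorem le_pHat (h : History K) {p : Fin K → ℝ} (hp : ∀ j, 0 ≤ p j) (i : Fin K) :
    p i ≤ pHat h p i :=
  le_add_of_nonneg_right (Finset.sum_nonneg fun j _ => mul_nonneg (qHat_nonneg h j i) (hp j))

/-- If all scores lie in `[-s, s]` with `2 η s ≤ 1`, all weights are within a factor `e ≤ 3` of
uniform. -/
theorem expWeights_ge [NeZero K] (θ : Params) (hη : 0 ≤ θ.η) {S : Fin K → ℝ} {s : ℝ}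
    (hS : ∀ j, |S j| ≤ s) (hs : 2 * (θ.η * s) ≤ 1) (i : Fin K) :
    1 / (3 * K : ℝ) ≤ expWeights θ S i := by
  have hK : (0 : ℝ) < K := Nat.cast_pos.2 (NeZero.pos K)
  have hγ0 : (0 : ℝ) ≤ θ.γ := θ.γ.2.1
  have hγ1 : (θ.γ : ℝ) ≤ 1 := θ.γ.2.2
  have h1 : ∀ j, Real.exp (θ.η * S j) ≤ 3 * Real.exp (θ.η * S i) := by
    intro j
    have h2 : θ.η * S j ≤ 1 + θ.η * S i := by
      have ha := mul_le_mul_of_nonneg_left (abs_le.1 (hS j)).2 hη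
      have hb := mul_le_mul_of_nonneg_left (abs_le.1 (hS i)).1 hη
      linarith
    calc Real.exp (θ.η * S j) ≤ Real.exp (1 + θ.η * S i) := Real.exp_le_exp.2 h2
      _ = Real.exp 1 * Real.exp (θ.η * S i) := Real.exp_add _ _
      _ ≤ _ := by gcongr; linarith [Real.exp_one_lt_d9]
  have h3 : ∑ j, Real.exp (θ.η * S j) ≤ 3 * K * Real.exp (θ.η * S i) := by
    calc _ ≤ ∑ _j : Fin K, 3 * Real.exp (θ.η * S i) := Finset.sum_le_sum fun j _ => h1 j
      _ = _ := by simp; ring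
  have h4 : 1 / (3 * K : ℝ) ≤ Real.exp (θ.η * S i) / ∑ j, Real.exp (θ.η * S j) := by
    rw [div_le_div_iff₀ (by positivity)
      (Finset.sum_pos (fun j _ => Real.exp_pos _) Finset.univ_nonempty)]
    linarith
  have h5 : 1 / (3 * K : ℝ) ≤ 1 / K := by
    apply one_div_le_one_div_of_le hK; linarith
  unfold expWeights
  calc 1 / (3 * K : ℝ) = (1 - (θ.γ : ℝ)) * (1 / (3 * K)) + θ.γ * (1 / (3 * K)) := by ring
    _ ≤ (1 - (θ.γ : ℝ)) * (Real.exp (θ.η * S i) / ∑ j, Real.exp (θ.η * S j)) + θ.γ * (1 / K) := by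
      gcongr
    _ = _ := by ring

theorem gain_eq_neg_visitedLoss (θ : Params) (hB : θ.B ≠ 0) (len : Lengths K) (w : Walk K)
    (i : Fin K) :
    (hittingTime len w i - θ.B) / θ.B * (if i ∈ w then 1 else 0) = -visitedLoss θ len w i := by
  rw [visitedLoss]
  split_ifs with h
  · field_simp; ring
  · simp [hittingTime_of_not_mem h]

theorem visitedLoss_le_one (θ : Params) (hB : 0 < θ.B) {len : Lengths K}
    (hlen : ∀ x y, 0 ≤ len x y ∧ len x y ≤ 1) (w : Walk K) (i : Fin K) :
    visitedLoss θ len w i ≤ 1 := by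
  have h1 : 0 ≤ 1 / θ.B * hittingTime len w i :=
    mul_nonneg (by positivity) (hittingTime_bounds hlen w i).1
  rw [visitedLoss]
  split_ifs <;> linarith

theorem visitedLoss_nonneg (θ : Params) (hB : 0 < θ.B) {len : Lengths K}
    (hlen : ∀ x y, 0 ≤ len x y ∧ len x y ≤ 1) {w : Walk K} (hw : (w.length : ℝ) ≤ θ.B)
    (i : Fin K) : 0 ≤ visitedLoss θ len w i := by
  rw [visitedLoss]
  split_ifs with h
  · have h1 : 1 / θ.B * hittingTime len w i ≤ 1 := by
      rw [one_div_mul_eq_div, div_le_one hB]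
      exact (hittingTime_bounds hlen w i).2.trans hw
    linarith
  · simp [hittingTime_of_not_mem h]

theorem estimator_eq (θ : Params) (hB : θ.B ≠ 0) (len : Lengths K) (h : History K)
    (p : Fin K → ℝ) (w : Walk K) (i : Fin K) :
    estimator θ len h p w i = (θ.β - visitedLoss θ len w i) / pHat h p i := by
  rw [estimator, gain_eq_neg_visitedLoss θ hB]
  ring

section Early

variable [NeZero K] (θ : Params) (adv : History K → Lengths K)
  (hadv : ∀ h x y, 0 ≤ adv h x y ∧ adv h x y ≤ 1) (hB : 0 < θ.B) (hβ : 0 ≤ θ.β) (hη : 0 ≤ θ.η)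
include hadv hB hβ hη

/-- As long as `η` times the number of epochs is small, the scores have no effect on the order of
magnitude of the play distribution. -/
theorem abs_cumEstimate_le (h : History K) (hw : ∀ w ∈ h, (w.length : ℝ) ≤ θ.B)
    (hh : 6 * K * (θ.η * ((1 + θ.β) * h.length)) ≤ 1) (i : Fin K) :
    |cumEstimate θ adv h i| ≤ 3 * K * ((1 + θ.β) * h.length) := by
  have hK : (0 : ℝ) < K := Nat.cast_pos.2 (NeZero.pos K)
  induction h generalizing i with
  | nil => simp [cumEstimate]
  | cons w h ih =>
    simp only [List.length_cons, Nat.cast_add, Nat.cast_one] at hh ⊢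
    have hh' : 6 * K * (θ.η * ((1 + θ.β) * h.length)) ≤ 1 := by
      refine le_trans ?_ hh
      gcongr
      linarith
    have ih' := ih (fun v hv => hw v (List.mem_cons_of_mem w hv)) hh'
    have hp := expWeights_ge θ hη ih' (by linarith) i
    have hp2 := hp.trans (le_pHat h (fun j => expWeights_nonneg θ _ j) i)
    have hp0 : 0 < pHat h (expWeights θ (cumEstimate θ adv h)) i :=
      lt_of_lt_of_le (by positivity) hp2
    have hwB := hw w List.mem_cons_self
    have hy0 := visitedLoss_nonneg θ hB (hadv h) hwB i
    have hy1 := visitedLoss_le_one θ hB (hadv h) w i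
    have he : |estimator θ (adv h) h (expWeights θ (cumEstimate θ adv h)) w i|
        ≤ 3 * K * (1 + θ.β) := by
      rw [estimator_eq θ hB.ne', abs_div, abs_of_pos hp0, div_le_iff₀ hp0]
      have h1 : |θ.β - visitedLoss θ (adv h) w i| ≤ 1 + θ.β := by
        rw [abs_le]; constructor <;> linarith
      have h2 : 1 ≤ 3 * K * pHat h (expWeights θ (cumEstimate θ adv h)) i := by
        rw [div_le_iff₀ (by positivity)] at hp2; linarith
      nlinarith
    simp only [cumEstimate]
    calc _ ≤ 3 * K * ((1 + θ.β) * h.length) + 3 * K * (1 + θ.β) :=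
          (abs_add_le _ _).trans (add_le_add (ih' i) he)
      _ = _ := by ring

theorem neg_zHat_le_early (h : History K) (hw : ∀ w ∈ h, (w.length : ℝ) ≤ θ.B)
    (hh : 6 * K * (θ.η * ((1 + θ.β) * h.length)) ≤ 1) (w : Walk K) (i : Fin K) :
    -zHat θ adv h w i ≤ 3 * K := by
  have hK : (0 : ℝ) < K := Nat.cast_pos.2 (NeZero.pos K)
  have hp := expWeights_ge θ hη (abs_cumEstimate_le θ adv hadv hB hβ hη h hw hh) (by linarith) i
  have hp2 := hp.trans (le_pHat h (fun j => expWeights_nonneg θ _ j) i)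
  have hp0 : 0 < pHat h (expWeights θ (cumEstimate θ adv h)) i :=
    lt_of_lt_of_le (by positivity) hp2
  have hy1 := visitedLoss_le_one θ hB (hadv h) w i
  rw [zHat, estimator_eq θ hB.ne', playProb, ← neg_div, div_le_iff₀ hp0]
  have h2 : 1 ≤ 3 * K * pHat h (expWeights θ (cumEstimate θ adv h)) i := by
    rw [div_le_iff₀ (by positivity)] at hp2; linarith
  linarith

end Early

section Late

variable [NeZero K] (G : Chain K) (θ : Params) (adv : History K → Lengths K)

theorem abs_pHat_sub_visitMass_le (h : History K) (i : Fin K) {d : ℝ} (hd : 0 ≤ d)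
    (hq : ∀ j, |qHat h j i - G.visitProb j i| ≤ d) :
    |pHat h (playProb θ adv h) i - G.visitMass (playProb θ adv h) i| ≤ d := by
  have h1 : pHat h (playProb θ adv h) i - G.visitMass (playProb θ adv h) i
      = ∑ j ∈ Finset.univ.erase i, (qHat h j i - G.visitProb j i) * playProb θ adv h j := by
    rw [pHat, Chain.visitMass, ← Finset.add_sum_erase _ _ (Finset.mem_univ i), G.visitProb_self]
    simp only [sub_mul, Finset.sum_sub_distrib]
    rw [Finset.sum_congr rfl fun j _ => mul_comm (playProb θ adv h j) (G.visitProb j i)]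
    ring
  rw [h1]
  calc _ ≤ ∑ j ∈ Finset.univ.erase i, d * playProb θ adv h j := by
        refine (Finset.abs_sum_le_sum_abs _ _).trans (Finset.sum_le_sum fun j _ => ?_)
        rw [abs_mul, abs_of_nonneg (playProb_nonneg θ adv h j)]
        exact mul_le_mul_of_nonneg_right (hq j) (playProb_nonneg θ adv h j)
    _ ≤ ∑ j, d * playProb θ adv h j :=
        Finset.sum_le_sum_of_subset_of_nonneg (Finset.erase_subset _ _) fun j _ _ =>
          mul_nonneg hd (playProb_nonneg θ adv h j)
    _ = d := by rw [← Finset.mul_sum, sum_playProb, mul_one]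

theorem pHat_ge (h : History K) (i : Fin K) {a : ℝ} (ha : a ≤ 1)
    (hq : ∀ j, a ≤ qHat h j i) : a ≤ pHat h (playProb θ adv h) i := by
  rw [pHat]
  calc a = a * playProb θ adv h i + ∑ j ∈ Finset.univ.erase i, a * playProb θ adv h j := by
        rw [Finset.add_sum_erase _ (fun j => a * playProb θ adv h j) (Finset.mem_univ i),
          ← Finset.mul_sum, sum_playProb, mul_one]
    _ ≤ 1 * playProb θ adv h i
        + ∑ j ∈ Finset.univ.erase i, qHat h j i * playProb θ adv h j := by
      refine add_le_add (mul_le_mul_of_nonneg_right ha (playProb_nonneg θ adv h i))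
        (Finset.sum_le_sum fun j _ => ?_)
      exact mul_le_mul_of_nonneg_right (hq j) (playProb_nonneg θ adv h j)
    _ = _ := by rw [one_mul]

omit [NeZero K] in
/-- Once `pHat` is close to the true visiting probability, the regret of an epoch is a martingale
increment up to the relative error of `pHat`. -/
theorem loss_sub_zHat_le (hB : 0 < θ.B) (hβ : 0 ≤ θ.β) (h : History K) (w : Walk K) (i : Fin K)
    {a d Λ : ℝ} (ha : 0 < a) (hp : a ≤ pHat h (playProb θ adv h) i) (hd : 0 ≤ d)
    (hpd : |pHat h (playProb θ adv h) i - G.visitMass (playProb θ adv h) i| ≤ d)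
    (hΛ : |1 - G.expHittingTime (adv h) i / θ.B| ≤ Λ) :
    (G.expHittingTime (adv h) i - θ.B) / θ.B - zHat θ adv h w i
      ≤ 1 / pHat h (playProb θ adv h) i * (visitedLoss θ (adv h) w i - meanLoss G θ adv h i)
        + Λ * d / a := by
  rw [zHat, estimator_eq θ hB.ne', meanLoss]
  set P := pHat h (playProb θ adv h) i
  set v := G.visitMass (playProb θ adv h) i
  set y := visitedLoss θ (adv h) w i
  set x := 1 - G.expHittingTime (adv h) i / θ.B with hx
  have hP : 0 < P := ha.trans_le hp
  have h1 : (G.expHittingTime (adv h) i - θ.B) / θ.B = -x := by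
    rw [hx]; field_simp; ring
  have hΛ0 : 0 ≤ Λ := (abs_nonneg _).trans hΛ
  have h2 : x * (v - P) / P ≤ Λ * d / a := by
    have h3 : x * (v - P) ≤ Λ * d := (le_abs_self _).trans (by
      rw [abs_mul, abs_sub_comm v P]
      exact mul_le_mul hΛ hpd (abs_nonneg _) hΛ0)
    exact (div_le_div_of_nonneg_right h3 hP.le).trans
      (div_le_div_of_nonneg_left (by positivity) ha hp)
  have h4 : 0 ≤ θ.β / P := by positivity
  have h5 : -x - (θ.β - y) / P = 1 / P * (y - v * x) + x * (v - P) / P - θ.β / P := by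
    field_simp; ring
  rw [h1, h5]
  linarith

end Late

/-! ### Accuracy of the empirical frequencies -/

/-- Number of epochs, in units of `log (T / ε)`, after which the empirical frequencies are within
`α / 2` of the visiting probabilities. -/
def burnIn (α : ℝ) : ℝ := 512 / α ^ 4

theorem burnIn_ge {α : ℝ} (hα0 : 0 < α) (hα1 : α ≤ 1) :
    512 ≤ burnIn α ∧ 32 / α ≤ burnIn α ∧ 32 / α ^ 2 ≤ burnIn α := by
  have h4 : α ^ 4 ≤ 1 := pow_le_one₀ hα0.le hα1
  have h41 : α ^ 4 ≤ α := by simpa using pow_le_pow_of_le_one hα0.le hα1 (show 1 ≤ 4 by norm_num)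
  have h42 : α ^ 4 ≤ α ^ 2 := pow_le_pow_of_le_one hα0.le hα1 (by norm_num)
  unfold burnIn
  refine ⟨?_, ?_, ?_⟩
  · rw [le_div_iff₀ (by positivity)]; linarith
  · gcongr; norm_num
  · gcongr; norm_num

theorem abs_qHat_sub_le {α ℓ : ℝ} (hα0 : 0 < α) (hα1 : α ≤ 1) (hℓ : 1 ≤ ℓ) (h : History K)
    (i j : Fin K) (q : ℝ) (hh : burnIn α * ℓ ≤ 2 * h.length)
    (h1 : sumEpochs (fun _ w => α / 4 - 1 / 2 * if j ∈ w then 1 else 0) h < ℓ)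
    (h2 : ∀ s : ℝ, |s| = Real.sqrt (ℓ / h.length) → sumEpochs (fun _ w =>
      s * ((if i ∈ suffixFrom j w then 1 else 0) - q * if j ∈ w then 1 else 0) - s ^ 2) h < ℓ) :
    |qHat h j i - q| ≤ 8 / α * Real.sqrt (ℓ / h.length) := by
  obtain ⟨hc1, hc2, -⟩ := burnIn_ge hα0 hα1
  set t : ℝ := (List.length h : ℝ) with ht
  set N : ℝ := (visitCount h j : ℝ) with hN
  have ht0 : 0 < t := by nlinarith
  have hαt : 16 * ℓ ≤ α * t := by
    rw [div_le_iff₀ hα0] at hc2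
    nlinarith [mul_le_mul_of_nonneg_left hh hα0.le,
      mul_le_mul_of_nonneg_right hc2 (show (0 : ℝ) ≤ ℓ by linarith)]
  rw [sumEpochs_visit, ← ht, ← hN] at h1
  have hN1 : α * t / 4 ≤ N := by linarith
  have hN0 : 0 < N := lt_of_lt_of_le (by positivity) hN1
  set s := Real.sqrt (ℓ / t) with hs
  have hs0 : 0 < s := Real.sqrt_pos.2 (by positivity)
  have hs2 : s ^ 2 = ℓ / t := Real.sq_sqrt (by positivity)
  have hst : t * s ^ 2 = ℓ := by rw [hs2]; field_simp
  have ha := h2 s (abs_of_pos hs0)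
  have hb := h2 (-s) (by rw [abs_neg, abs_of_pos hs0])
  rw [sumEpochs_revisit, ← ht, ← hN] at ha hb
  set M : ℝ := (h.countP (fun w => decide (i ∈ suffixFrom j w)) : ℝ) - q * N with hM
  rw [neg_sq, hst] at hb
  rw [hst] at ha
  have hM1 : |M| ≤ 2 * t * s := by
    have h3 : s * |M| ≤ s * (2 * t * s) := by
      rw [show s * (2 * t * s) = 2 * ℓ by rw [← hst]; ring]
      rcases abs_cases M with ⟨h4, -⟩ | ⟨h4, -⟩ <;> rw [h4] <;> linarith
    exact le_of_mul_le_mul_left h3 hs0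
  have h5 : qHat h j i - q = M / N := by
    rw [qHat, hM, ← hN]; field_simp
  rw [h5, abs_div, abs_of_pos hN0, div_le_iff₀ hN0]
  calc |M| ≤ 2 * t * s := hM1
    _ = 8 / α * s * (α * t / 4) := by field_simp; ring
    _ ≤ _ := by gcongr

/-! ### The regret on the good event -/

/-- The compensated regret increment; it is switched off before the end of the burn-in and unless
the weight `β / pHat` is small. -/
def compensatedLoss (G : Chain K) (θ : Params) (adv : History K → Lengths K) (α c ℓ V : ℝ)
    (i : Fin K) (h : History K) (w : Walk K) : ℝ :=
  open Classical in
  (if burnIn α * ℓ < h.length + 1 ∧ α / 2 ≤ pHat h (playProb θ adv h) i ∧ θ.β ≤ c then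
    θ.β / pHat h (playProb θ adv h) i * (visitedLoss θ (adv h) w i - meanLoss G θ adv h i)
  else 0) - θ.β ^ 2 * (4 * V / α ^ 2)

/-- Reciprocal of the constant limiting `β` and `η`: the summands keep the scores bounded before
the burn-in ends, the weights `β / pHat` small after it, and the sum of the error terms
below `log (T / ε)`. -/
def smallness (K : ℕ) (α Λ V : ℝ) : ℝ :=
  1 + 12 * K * burnIn α + 2 * Λ / α + 4 * V / α ^ 2 + 2 * ((Λ + 3 * K) * burnIn α)

section Good

variable [NeZero K] (G : Chain K) (θ : Params) (adv : History K → Lengths K) {ρ b α : ℝ}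
  (hρ0 : 0 < ρ) (hρ1 : ρ < 1) (hρ : ∀ i, ∑ j, G.m i j ≤ ρ) (hb : 0 < b) (hbB : b ≤ θ.B)
  (hadv : ∀ h x y, 0 ≤ adv h x y ∧ adv h x y ≤ 1) (hα0 : 0 < α) (hα1 : α ≤ 1) (hβ : 0 < θ.β)

omit [NeZero K] in
include hρ0 hρ1 hb in
theorem lossBound_ge : 2 ≤ lossBound ρ b ∧ 0 ≤ lossVarBound ρ b := by
  have h1 : 0 ≤ lengthSqBound ρ := lengthSqBound_nonneg hρ0 hρ1
  have h2 : 0 ≤ lengthSqBound ρ / b := by positivity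
  refine ⟨by rw [lossBound]; linarith, ?_⟩
  rw [lossVarBound]
  positivity

theorem mul_inv_smallness {K : ℕ} {α Λ V : ℝ} (hα0 : 0 < α) (hΛ : 0 ≤ Λ) (hV : 0 ≤ V) {c : ℝ}
    (hc : c = 1 / smallness K α Λ V) :
    0 < c ∧ c ≤ 1 ∧ 12 * K * burnIn α * c ≤ 1 ∧ 2 * Λ / α * c ≤ 1 ∧
      (4 * V / α ^ 2 + 2 * ((Λ + 3 * K) * burnIn α)) * c ≤ 1 := by
  have h0 : 0 < burnIn α := by unfold burnIn; positivity
  have h1 : 0 ≤ 12 * K * burnIn α := by positivity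
  have h2 : 0 ≤ 2 * Λ / α := by positivity
  have h3 : 0 ≤ 4 * V / α ^ 2 := by positivity
  have h4 : 0 ≤ 2 * ((Λ + 3 * K) * burnIn α) := by positivity
  have h5 : 0 < smallness K α Λ V := by unfold smallness; linarith
  have h6 : ∀ x, x ≤ smallness K α Λ V → x * c ≤ 1 := fun x hx => by
    rw [hc, mul_one_div, div_le_one h5]; exact hx
  refine ⟨by rw [hc]; positivity, by simpa using h6 1 (by unfold smallness; linarith), ?_, ?_, ?_⟩
  all_goals
    apply h6
    unfold smallness
    linarith

include hρ0 hρ1 hρ hb hbB hadv hα0 hβ in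
theorem lmean_exp_compensatedLoss_le_one {c : ℝ} (hc : 2 * lossBound ρ b / α * c ≤ 1) (ℓ : ℝ)
    (i : Fin K) (h : History K) :
    lmean (stepLaw G θ adv h) (fun w => ENNReal.ofReal (Real.exp
      (compensatedLoss G θ adv α c ℓ (lossVarBound ρ b) i h w))) ≤ 1 := by
  obtain ⟨hΛ, hV⟩ := lossBound_ge hρ0 hρ1 hb
  by_cases hp : burnIn α * ℓ < h.length + 1 ∧ α / 2 ≤ pHat h (playProb θ adv h) i ∧ θ.β ≤ c
  · simp only [compensatedLoss, if_pos hp]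
    obtain ⟨-, hp1, hp2⟩ := hp
    set P := pHat h (playProb θ adv h) i
    have hP : 0 < P := lt_of_lt_of_le (by positivity) hp1
    have hs : θ.β / P ≤ 2 * θ.β / α := by
      rw [div_le_div_iff₀ hP hα0]; nlinarith
    have hs0 : 0 ≤ θ.β / P := by positivity
    refine le_trans (lmean_mono fun w => ENNReal.ofReal_le_ofReal (Real.exp_le_exp.2 ?_))
      (lmean_exp_loss_le_one G θ adv hρ0 hρ1 hρ hb hbB hadv hs0 ?_ i h)
    · have h1 : (θ.β / P) ^ 2 * lossVarBound ρ b ≤ (2 * θ.β / α) ^ 2 * lossVarBound ρ b := by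
        gcongr
      have h2 : (2 * θ.β / α) ^ 2 * lossVarBound ρ b
          = θ.β ^ 2 * (4 * lossVarBound ρ b / α ^ 2) := by field_simp; ring
      linarith
    · calc θ.β / P * lossBound ρ b ≤ 2 * c / α * lossBound ρ b := by
            gcongr ?_ * _
            exact hs.trans (by gcongr)
        _ = 2 * lossBound ρ b / α * c := by ring
        _ ≤ 1 := hc
  · simp only [compensatedLoss, if_neg hp]
    refine (lmean_mono (F' := fun _ => 1) fun w => ?_).trans (lmean_const _ _).le
    rw [ENNReal.ofReal_le_one, Real.exp_le_one_iff, zero_sub, neg_nonpos]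
    positivity

/-- Before the burn-in ends, an epoch costs at most a constant, and such epochs are few. -/
theorem early_epoch_le (hB : 0 < θ.B) (hadv : ∀ h x y, 0 ≤ adv h x y ∧ adv h x y ≤ 1)
    (hβ : 0 < θ.β) {C Λ ℓ c : ℝ} (hC : 1 ≤ C) (hℓ : 1 ≤ ℓ) (hc0 : 0 < c) (hc1 : c ≤ 1)
    (hc : 12 * K * C * c ≤ 1) {T : ℕ} (hβT : θ.β ^ 2 * T ≤ c ^ 2 * ℓ) (hη : 0 ≤ θ.η)
    (hηc : θ.η * ℓ ≤ c) (h : History K) (w : Walk K) (i : Fin K)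
    (hlen : ∀ v ∈ h, (v.length : ℝ) ≤ θ.B) (hhT : (h.length : ℝ) ≤ T)
    (hph : (h.length : ℝ) + 1 ≤ C * ℓ) (hΛ : |1 - G.expHittingTime (adv h) i / θ.B| ≤ Λ - 1) :
    (G.expHittingTime (adv h) i - θ.B) / θ.B - zHat θ adv h w i
      ≤ (Λ + 3 * K) * C * Real.sqrt (ℓ / (h.length + 1)) := by
  set t : ℝ := (List.length h : ℝ) with ht
  have ht0 : 0 ≤ t := Nat.cast_nonneg _
  have hΛ0 : 0 ≤ Λ := by linarith [abs_nonneg (1 - G.expHittingTime (adv h) i / θ.B)]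
  have hβt : θ.β * t ≤ C * ℓ := by
    refine le_of_sq_le_sq ?_ (by positivity)
    calc (θ.β * t) ^ 2 = θ.β ^ 2 * t * t := by ring
      _ ≤ θ.β ^ 2 * T * t := by gcongr
      _ ≤ c ^ 2 * ℓ * (C * ℓ) := by gcongr; linarith
      _ ≤ C * ℓ * (C * ℓ) := by
        gcongr
        exact (pow_le_one₀ hc0.le hc1).trans hC
      _ = (C * ℓ) ^ 2 := by ring
  have hsmall : 6 * K * (θ.η * ((1 + θ.β) * t)) ≤ 1 := by
    calc 6 * K * (θ.η * ((1 + θ.β) * t))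
        ≤ 6 * K * (θ.η * (2 * (C * ℓ))) := by
          gcongr 6 * K * (θ.η * ?_)
          linarith
      _ = 12 * K * C * (θ.η * ℓ) := by ring
      _ ≤ 12 * K * C * c := by gcongr
      _ ≤ 1 := hc
  have hz := neg_zHat_le_early θ adv hadv hB hβ.le hη h hlen hsmall w i
  have hl : (G.expHittingTime (adv h) i - θ.B) / θ.B ≤ Λ - 1 := by
    have h1 : (G.expHittingTime (adv h) i - θ.B) / θ.B
        = -(1 - G.expHittingTime (adv h) i / θ.B) := by field_simp; ring
    rw [h1]
    exact (neg_le_abs _).trans hΛ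
  have hsq : 1 / C ≤ Real.sqrt (ℓ / (t + 1)) := by
    refine Real.le_sqrt_of_sq_le ?_
    rw [div_pow, one_pow, div_le_div_iff₀ (by positivity) (by positivity)]
    nlinarith
  calc (G.expHittingTime (adv h) i - θ.B) / θ.B - zHat θ adv h w i ≤ Λ + 3 * K := by linarith
    _ = (Λ + 3 * K) * C * (1 / C) := by field_simp
    _ ≤ _ := by gcongr

/-- After the burn-in `pHat` is accurate, and an epoch costs a martingale increment plus the
relative error of `pHat`. -/
theorem late_epoch_le (hB : 0 < θ.B) (hα0 : 0 < α) (hα1 : α ≤ 1) (hβ : 0 < θ.β)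
    (hvis : ∀ i j, α ≤ G.visitProb i j) {Λ ℓ : ℝ} (hℓ : 1 ≤ ℓ) (h : History K) (w : Walk K)
    (i : Fin K) (hph : burnIn α * ℓ < h.length + 1)
    (hq : ∀ j, |qHat h j i - G.visitProb j i| ≤ 8 / α * Real.sqrt (ℓ / h.length))
    (hΛ : |1 - G.expHittingTime (adv h) i / θ.B| ≤ Λ - 1) :
    α / 2 ≤ pHat h (playProb θ adv h) i ∧
    (G.expHittingTime (adv h) i - θ.B) / θ.B - zHat θ adv h w i
      ≤ 1 / pHat h (playProb θ adv h) i * (visitedLoss θ (adv h) w i - meanLoss G θ adv h i)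
        + (Λ + 3 * K) * burnIn α * Real.sqrt (ℓ / (h.length + 1)) := by
  obtain ⟨hC1, -, hC3⟩ := burnIn_ge hα0 hα1
  have hΛ1 : 0 ≤ Λ - 1 := (abs_nonneg _).trans hΛ
  set t : ℝ := (List.length h : ℝ) with ht
  have hCℓ : 512 ≤ burnIn α * ℓ := by nlinarith
  have ht0 : 1 ≤ t := by linarith
  have ht1 : burnIn α * ℓ ≤ 2 * t := by linarith
  have hsα : Real.sqrt (ℓ / t) ≤ α ^ 2 / 16 := by
    rw [Real.sqrt_le_left (by positivity), div_le_iff₀ (by linarith)]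
    rw [burnIn, div_mul_eq_mul_div, div_le_iff₀ (by positivity)] at ht1
    calc ℓ ≤ 2 * t * α ^ 4 / 512 := by linarith
      _ = _ := by ring
  have hdα : 8 / α * Real.sqrt (ℓ / t) ≤ α / 2 := by
    calc 8 / α * Real.sqrt (ℓ / t) ≤ 8 / α * (α ^ 2 / 16) := by gcongr
      _ = α / 2 := by field_simp; norm_num
  have hd0 : 0 ≤ 8 / α * Real.sqrt (ℓ / t) := by positivity
  have hp : α / 2 ≤ pHat h (playProb θ adv h) i :=
    pHat_ge θ adv h i (by linarith) fun j => by linarith [(abs_le.1 (hq j)).1, hvis j i]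
  refine ⟨hp, (loss_sub_zHat_le G θ adv hB hβ.le h w i (by positivity) hp hd0
    (abs_pHat_sub_visitMass_le G θ adv h i hd0 hq) hΛ).trans ?_⟩
  gcongr
  have h1 : Real.sqrt (ℓ / t) ≤ 2 * Real.sqrt (ℓ / (t + 1)) := by
    rw [Real.sqrt_le_left (by positivity), mul_pow, Real.sq_sqrt (by positivity),
      ← mul_div_assoc, div_le_div_iff₀ (by linarith) (by linarith)]
    nlinarith
  calc (Λ - 1) * (8 / α * Real.sqrt (ℓ / t)) / (α / 2)
      = (Λ - 1) * (16 / α ^ 2) * Real.sqrt (ℓ / t) := by field_simp; ring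
    _ ≤ (Λ - 1) * (16 / α ^ 2) * (2 * Real.sqrt (ℓ / (t + 1))) := by gcongr
    _ = (Λ - 1) * (32 / α ^ 2) * Real.sqrt (ℓ / (t + 1)) := by ring
    _ ≤ (Λ + 3 * K) * burnIn α * Real.sqrt (ℓ / (t + 1)) := by
      have hΛK : Λ - 1 ≤ Λ + 3 * K := by linarith [Nat.cast_nonneg (α := ℝ) K]
      have hΛ0 := hΛ1.trans hΛK
      gcongr

include hρ0 hρ1 hρ hb hbB hadv hα0 hα1 hβ in
/-- If no walk is longer than `B`, the empirical frequencies concentrate after the burn-in, and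
the compensated losses have a small sum, then the regret bound holds. -/
theorem regret_le_of_concentration (hvis : ∀ i j, α ≤ G.visitProb i j) {ℓ c u : ℝ} (hℓ : 1 ≤ ℓ)
    (hc : c = 1 / smallness K α (lossBound ρ b) (lossVarBound ρ b)) {T : ℕ} (hT : 1 ≤ T)
    (hβc : θ.β ≤ c * Real.sqrt (ℓ / T)) (hη : 0 ≤ θ.η) (hηc : θ.η * ℓ ≤ c)
    (ω : History K) (hω : ω.length = T) (i : Fin K)
    (hlen : ∀ w ∈ ω, (w.length : ℝ) ≤ θ.B)
    (hvisit : ∀ j, ∀ h, h <:+ ω → burnIn α * ℓ < h.length + 1 →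
      sumEpochs (fun _ w => α / 4 - 1 / 2 * if j ∈ w then 1 else 0) h < ℓ)
    (hrevisit : ∀ j, ∀ h, h <:+ ω → burnIn α * ℓ < h.length + 1 →
      ∀ s : ℝ, |s| = Real.sqrt (ℓ / h.length) → sumEpochs (fun _ w =>
        s * ((if i ∈ suffixFrom j w then 1 else 0) - G.visitProb j i * if j ∈ w then 1 else 0)
          - s ^ 2) h < ℓ)
    (hcomp : sumEpochs (compensatedLoss G θ adv α c ℓ (lossVarBound ρ b) i) ω ≤ u) :
    θ.β * (sumEpochs (fun h _ => (G.expHittingTime (adv h) i - θ.B) / θ.B) ω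
      - sumEpochs (fun h w => zHat θ adv h w i) ω) ≤ u + ℓ := by
  obtain ⟨hΛ, hV⟩ := lossBound_ge hρ0 hρ1 hb
  set Λ := lossBound ρ b with hΛdef
  set V := lossVarBound ρ b with hVdef
  obtain ⟨hc0, hc1, hc2, hc3, hc4⟩ := mul_inv_smallness (K := K) hα0 (by linarith) hV hc
  obtain ⟨hC1, hC2, hC3⟩ := burnIn_ge hα0 hα1
  have hK : (1 : ℝ) ≤ K := Nat.one_le_cast.2 (NeZero.pos K)
  have hB : 0 < θ.B := hb.trans_le hbB
  have hT0 : (1 : ℝ) ≤ T := Nat.one_le_cast.2 hT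
  have hβ2 : θ.β ^ 2 * T ≤ c ^ 2 * ℓ := by
    have h1 : θ.β ^ 2 ≤ (c * Real.sqrt (ℓ / T)) ^ 2 := pow_le_pow_left₀ hβ.le hβc 2
    rw [mul_pow, Real.sq_sqrt (by positivity)] at h1
    calc θ.β ^ 2 * T ≤ c ^ 2 * (ℓ / T) * T := by gcongr
      _ = c ^ 2 * ℓ := by field_simp
  have hβT : θ.β * Real.sqrt T ≤ c * Real.sqrt ℓ := by
    calc θ.β * Real.sqrt T ≤ c * Real.sqrt (ℓ / T) * Real.sqrt T := by gcongr
      _ = c * Real.sqrt ℓ := by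
        rw [mul_assoc, ← Real.sqrt_mul (by positivity)]
        congr 2
        field_simp
  set R : ℝ := (Λ + 3 * K) * burnIn α with hR
  -- `r t` collects the compensator of epoch `t` and the common bound on the early cost and on the
  -- relative error of `pHat`.
  set r : ℕ → ℝ := fun t => θ.β ^ 2 * (4 * V / α ^ 2)
    + θ.β * R * Real.sqrt ℓ * (1 / Real.sqrt ((t : ℝ) + 1)) with hr
  have hstep : ∀ h w, (w :: h) <:+ ω →
      θ.β * ((G.expHittingTime (adv h) i - θ.B) / θ.B - zHat θ adv h w i)
        ≤ compensatedLoss G θ adv α c ℓ V i h w + r h.length := by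
    intro h w hwh
    have hhω : h <:+ ω := (List.suffix_cons w h).trans hwh
    have htT : h.length + 1 ≤ T := by
      rw [← hω]; simpa using hwh.length_le
    have htT' : (h.length : ℝ) + 1 ≤ T := by exact_mod_cast htT
    have hx := one_sub_div_bounds G θ adv hρ0 hρ1 hρ hb hbB hadv h i
    rw [← hΛdef] at hx
    have hsqrt : Real.sqrt ℓ * (1 / Real.sqrt ((h.length : ℝ) + 1))
        = Real.sqrt (ℓ / (h.length + 1)) := by
      rw [Real.sqrt_div' _ (by positivity)]; ring
    have hr' : r h.length = θ.β ^ 2 * (4 * V / α ^ 2)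
        + θ.β * (R * Real.sqrt (ℓ / (h.length + 1))) := by
      rw [hr, ← hsqrt]; ring
    rw [hr']
    rcases le_or_gt ((h.length : ℝ) + 1) (burnIn α * ℓ) with hph | hph
    · have hcl : compensatedLoss G θ adv α c ℓ V i h w = -(θ.β ^ 2 * (4 * V / α ^ 2)) := by
        simp only [compensatedLoss, if_neg fun H : _ ∧ _ => hph.not_gt H.1, zero_sub]
      have h7 := early_epoch_le G θ adv hB hadv hβ (by linarith) hℓ hc0 hc1 hc2 hβ2 hη hηc h w i
        (fun v hv => hlen v (hhω.subset hv)) (by linarith) hph hx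
      have h8 := mul_le_mul_of_nonneg_left h7 hβ.le
      linarith
    · have hCℓ : burnIn α ≤ burnIn α * ℓ := le_mul_of_one_le_right (by linarith) hℓ
      have hℓC : ℓ ≤ burnIn α * ℓ := le_mul_of_one_le_left (by linarith) (by linarith)
      obtain ⟨hp, hmain⟩ := late_epoch_le G θ adv hB hα0 hα1 hβ hvis hℓ h w i hph (fun j =>
        abs_qHat_sub_le hα0 hα1 hℓ h i j _ (by linarith) (hvisit j h hhω hph)
          (hrevisit j h hhω hph)) hx
      have hβc1 : θ.β ≤ c := by
        refine hβc.trans (mul_le_of_le_one_right hc0.le ?_)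
        rw [Real.sqrt_le_one, div_le_one (by linarith)]
        linarith
      have hcl : compensatedLoss G θ adv α c ℓ V i h w + θ.β ^ 2 * (4 * V / α ^ 2)
          = θ.β * (1 / pHat h (playProb θ adv h) i
            * (visitedLoss θ (adv h) w i - meanLoss G θ adv h i)) := by
        simp only [compensatedLoss, if_pos (And.intro hph (And.intro hp hβc1))]
        ring
      have h4 := mul_le_mul_of_nonneg_left hmain hβ.le
      rw [mul_add] at h4
      linarith
  rw [sumEpochs_mul_sub]
  refine (sumEpochs_le_add_sum hstep).trans ?_
  rw [hω]
  have hsum : ∑ t ∈ Finset.range T, r t ≤ ℓ := by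
    simp only [hr, Finset.sum_add_distrib, ← Finset.mul_sum, Finset.sum_const, Finset.card_range,
      nsmul_eq_mul]
    have hR0 : 0 ≤ R := by positivity
    have h1 : θ.β * R * Real.sqrt ℓ * ∑ t ∈ Finset.range T, 1 / Real.sqrt ((t : ℝ) + 1)
        ≤ 2 * R * c * ℓ := by
      calc _ ≤ θ.β * R * Real.sqrt ℓ * (2 * Real.sqrt T) := by
            gcongr; exact sum_inv_sqrt_le T
        _ = 2 * R * Real.sqrt ℓ * (θ.β * Real.sqrt T) := by ring
        _ ≤ 2 * R * Real.sqrt ℓ * (c * Real.sqrt ℓ) := by gcongr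
        _ = 2 * R * c * (Real.sqrt ℓ * Real.sqrt ℓ) := by ring
        _ = _ := by rw [Real.mul_self_sqrt (by linarith)]
    have h2 : T * (θ.β ^ 2 * (4 * V / α ^ 2)) ≤ 4 * V / α ^ 2 * c * ℓ := by
      calc T * (θ.β ^ 2 * (4 * V / α ^ 2)) = 4 * V / α ^ 2 * (θ.β ^ 2 * T) := by ring
        _ ≤ 4 * V / α ^ 2 * (c ^ 2 * ℓ) := by gcongr
        _ ≤ 4 * V / α ^ 2 * (c * ℓ) := by gcongr; nlinarith
        _ = _ := by ring
    have h3 := mul_le_mul_of_nonneg_right hc4 (show (0 : ℝ) ≤ ℓ by linarith)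
    linarith
  linarith

end Good

/-! ### Probability of the good event -/

theorem one_sub_le_prob {Ω : Type*} (P : PMF Ω) {s : Set Ω} {x : ℝ} (hx : 0 ≤ x)
    (h : P.toOuterMeasure sᶜ ≤ ENNReal.ofReal x) : 1 - x ≤ prob P s := by
  have h1 : P.toOuterMeasure s ≠ ⊤ := by
    refine ne_top_of_le_ne_top ENNReal.one_ne_top ?_
    rw [toOuterMeasure_eq_lmean]
    refine (lmean_mono (F' := fun _ => 1) fun w => ?_).trans (lmean_const _ _).le
    exact Set.indicator_le_self' (fun _ _ => zero_le) w
  have h2 : (1 : ℝ≥0∞) ≤ P.toOuterMeasure s + P.toOuterMeasure sᶜ := by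
    calc (1 : ℝ≥0∞) = P.toOuterMeasure (s ∪ sᶜ) := by
          rw [Set.union_compl_self, toOuterMeasure_eq_lmean, Set.indicator_univ]
          exact (lmean_const P 1).symm
      _ ≤ _ := MeasureTheory.measure_union_le _ _
  have h4 : 0 ≤ prob P s := ENNReal.toReal_nonneg
  have h3 : ENNReal.ofReal 1 ≤ ENNReal.ofReal (prob P s + x) := by
    rw [ENNReal.ofReal_add h4 hx, prob, ENNReal.ofReal_toReal h1,
      ENNReal.ofReal_one]
    exact h2.trans (by gcongr)
  linarith [(ENNReal.ofReal_le_ofReal_iff (by linarith)).1 h3]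

section Game

variable [NeZero K] (G : Chain K) (θ : Params) (adv : History K → Lengths K)

/-- Chernoff bound, uniformly over all pasts with more than `n₀ - 1` epochs. The increments may be
tuned to the number of epochs. -/
theorem gameLaw_exists_sumEpochs_ge (F : ℕ → History K → Walk K → ℝ) {n₀ ℓ : ℝ}
    (hF : ∀ n : ℕ, n₀ < n + 1 → ∀ h,
      lmean (stepLaw G θ adv h) (fun w => ENNReal.ofReal (Real.exp (F n h w))) ≤ 1) (T : ℕ) :
    (gameLaw G θ adv T).toOuterMeasure
      {ω | ∃ h, h <:+ ω ∧ n₀ < h.length + 1 ∧ ℓ ≤ sumEpochs (F h.length) h}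
      ≤ (T + 1) * ENNReal.ofReal (Real.exp (-ℓ)) := by
  refine gameLaw_exists_suffix_le G θ adv
    (S := {h | n₀ < h.length + 1 ∧ ℓ ≤ sumEpochs (F h.length) h}) (fun n => ?_) T
  by_cases hn : n₀ < n + 1
  · refine (MeasureTheory.measure_mono ?_).trans (gameLaw_sumEpochs_ge G θ adv (hF n hn) n ℓ)
    rintro h ⟨⟨-, h1⟩, rfl⟩
    exact h1
  · have : {h : History K | n₀ < h.length + 1 ∧ ℓ ≤ sumEpochs (F h.length) h} ∩ {h | h.length = n}
        = ∅ := by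
      refine Set.eq_empty_of_forall_notMem ?_
      rintro h ⟨⟨h1, -⟩, rfl⟩
      exact hn h1
    rw [this, MeasureTheory.measure_empty]
    exact zero_le

theorem succ_mul_ofReal_le {T : ℕ} (hT : 1 ≤ T) {x y : ℝ} (hx : 0 ≤ x) (h : T * x ≤ y) :
    ((T : ℝ≥0∞) + 1) * ENNReal.ofReal x ≤ ENNReal.ofReal (2 * y) := by
  have h1 : ((T : ℝ≥0∞) + 1) = ENNReal.ofReal (T + 1) := by
    rw [ENNReal.ofReal_add (by positivity) (by positivity)]; simp
  rw [h1, ← ENNReal.ofReal_mul (by positivity)]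
  refine ENNReal.ofReal_le_ofReal ?_
  have hT' : (1 : ℝ) ≤ T := Nat.one_le_cast.2 hT
  nlinarith

section Bad

variable {ρ α : ℝ} (hρ0 : 0 < ρ) (hρ : ∀ i, ∑ j, G.m i j ≤ ρ)
  {T : ℕ} (hT : 1 ≤ T) {ε : ℝ} (hε : 0 < ε)

include hρ0 hρ hT in
/-- The choice of `B` makes walks longer than `B` unlikely. -/
theorem gameLaw_long_walk_le (hB : 0 ≤ θ.B) (hρ1 : ρ < 1)
    (hBε : T * ρ ^ θ.B ≤ ε) :
    (gameLaw G θ adv T).toOuterMeasure {ω | ∃ w ∈ ω, θ.B < w.length}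
      ≤ ENNReal.ofReal (2 * (ε / ρ)) := by
  have h1 := gameLaw_mem_long_le G θ adv hρ ⌊θ.B⌋₊ T
  rw [← ENNReal.ofReal_pow hρ0.le] at h1
  refine (MeasureTheory.measure_mono ?_).trans (h1.trans
    (succ_mul_ofReal_le hT (by positivity) ?_))
  · rintro ω ⟨w, hw, hwB⟩
    exact ⟨w, hw, (Nat.floor_lt hB).2 hwB⟩
  · have h2 : ρ ^ ⌊θ.B⌋₊ ≤ ρ ^ θ.B / ρ := by
      rw [← Real.rpow_sub_one hρ0.ne', ← Real.rpow_natCast]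
      exact Real.rpow_le_rpow_of_exponent_ge hρ0 hρ1.le (by linarith [Nat.lt_floor_add_one θ.B])
    calc T * ρ ^ ⌊θ.B⌋₊ ≤ T * (ρ ^ θ.B / ρ) := by gcongr
      _ = T * ρ ^ θ.B / ρ := by ring
      _ ≤ ε / ρ := by gcongr

include hT hε in
theorem gameLaw_frequency_le (hα0 : 0 < α) (hα1 : α ≤ 1) (hvis : ∀ i j, α ≤ G.visitProb i j)
    (hℓ : 1 ≤ Real.log (T / ε)) (i j : Fin K) :
    (gameLaw G θ adv T).toOuterMeasure
      {ω | ∃ h, h <:+ ω ∧ burnIn α * Real.log (T / ε) < h.length + 1 ∧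
        (Real.log (T / ε) ≤ sumEpochs (fun _ w => α / 4 - 1 / 2 * if j ∈ w then 1 else 0) h ∨
        ∃ s : ℝ, |s| = Real.sqrt (Real.log (T / ε) / h.length) ∧
          Real.log (T / ε) ≤ sumEpochs (fun _ w =>
            s * ((if i ∈ suffixFrom j w then 1 else 0) - G.visitProb j i * if j ∈ w then 1 else 0)
              - s ^ 2) h)} ≤ ENNReal.ofReal (6 * ε) := by
  set ℓ := Real.log (T / ε) with hℓdef
  have hT' : (0 : ℝ) < T := Nat.cast_pos.2 hT
  have hexp : (T : ℝ) * Real.exp (-ℓ) ≤ ε := by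
    rw [Real.exp_neg, hℓdef, Real.exp_log (by positivity)]
    field_simp
    exact le_rfl
  have hF : ∀ (F : ℕ → History K → Walk K → ℝ), (∀ n : ℕ, burnIn α * ℓ < n + 1 → ∀ h,
      lmean (stepLaw G θ adv h) (fun w => ENNReal.ofReal (Real.exp (F n h w))) ≤ 1) →
      (gameLaw G θ adv T).toOuterMeasure
        {ω | ∃ h, h <:+ ω ∧ burnIn α * ℓ < h.length + 1 ∧ ℓ ≤ sumEpochs (F h.length) h}
        ≤ ENNReal.ofReal (2 * ε) := fun F hF =>
    (gameLaw_exists_sumEpochs_ge G θ adv F hF T).trans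
      (succ_mul_ofReal_le hT (Real.exp_pos _).le hexp)
  have h1 := hF (fun _ _ w => α / 4 - 1 / 2 * if j ∈ w then 1 else 0)
    fun _ _ h => lmean_exp_visit_le_one G θ adv hvis j h
  have h2 : ∀ σ : ℝ, |σ| = 1 → _ := fun σ hσ => hF (fun n _ w =>
    σ * Real.sqrt (ℓ / n) * ((if i ∈ suffixFrom j w then 1 else 0)
      - G.visitProb j i * if j ∈ w then 1 else 0) - (σ * Real.sqrt (ℓ / n)) ^ 2)
    fun n hn h => lmean_exp_revisit_le_one G θ adv (by
      rw [abs_mul, hσ, one_mul, abs_of_nonneg (Real.sqrt_nonneg _), Real.sqrt_le_one]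
      refine div_le_one_of_le₀ ?_ (Nat.cast_nonneg n)
      obtain ⟨hC, -⟩ := burnIn_ge hα0 hα1
      nlinarith) i j h
  have h3 := h2 1 (by simp)
  have h4 := h2 (-1) (by simp)
  simp only [one_mul, neg_mul] at h3 h4
  rw [show 6 * ε = 2 * ε + 2 * ε + 2 * ε by ring, ENNReal.ofReal_add (by positivity)
    (by positivity), ENNReal.ofReal_add (by positivity) (by positivity)]
  refine le_trans (MeasureTheory.measure_mono ?_) ((MeasureTheory.measure_union_le _ _).trans
    (add_le_add ((MeasureTheory.measure_union_le _ _).trans (add_le_add h1 h3)) h4))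
  rintro ω ⟨h, hh, hn, h5 | ⟨s, hs, h5⟩⟩
  · exact Or.inl (Or.inl ⟨h, hh, hn, h5⟩)
  · rcases eq_or_eq_neg_of_abs_eq hs with rfl | rfl
    · exact Or.inl (Or.inr ⟨h, hh, hn, h5⟩)
    · refine Or.inr ⟨h, hh, hn, ?_⟩
      simpa only [neg_mul] using h5

end Bad

end Game

/-! ### Choice of the constants -/

/-- The condition on `B` in two usable forms. -/
theorem shift_bounds [NeZero K] {ρ ε B : ℝ} (hρ0 : 0 < ρ) (hρ1 : ρ < 1) {T : ℕ} (hT : 1 ≤ T)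
    (hε1 : ε < 1) (h : K * T * ρ ^ B / (1 - ρ) ≤ ε) :
    0 < Real.log (1 - ρ) / Real.log ρ ∧ Real.log (1 - ρ) / Real.log ρ ≤ B ∧ T * ρ ^ B ≤ ε := by
  have hK : (1 : ℝ) ≤ K := Nat.one_le_cast.2 (NeZero.pos K)
  have hT' : (1 : ℝ) ≤ T := Nat.one_le_cast.2 hT
  have hρ' : 0 < 1 - ρ := by linarith
  have hlogρ : Real.log ρ < 0 := Real.log_neg hρ0 hρ1
  have hx : 0 < ρ ^ B := Real.rpow_pos_of_pos hρ0 B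
  rw [div_le_iff₀ hρ'] at h
  have hTx : T * ρ ^ B ≤ ε * (1 - ρ) := by
    refine le_trans ?_ h
    rw [mul_assoc]
    exact le_mul_of_one_le_left (by positivity) hK
  have hTx0 : 0 < T * ρ ^ B := by positivity
  have hε : 0 < ε := by
    by_contra h0
    nlinarith
  refine ⟨div_pos_of_neg_of_neg (Real.log_neg hρ' (by linarith)) hlogρ, ?_, by nlinarith⟩
  rw [div_le_iff_of_neg hlogρ, ← Real.log_rpow hρ0]
  exact Real.log_le_log hx (by nlinarith)

end RandomWalkBandit

end

open RandomWalkBandit in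
theorem mainTheorem2 (K : ℕ) [NeZero K] (ρ α : ℝ) (hρ0 : 0 < ρ) (hρ1 : ρ < 1) (hα : 0 < α) :
    ∃ c : ℝ, 0 < c ∧ ∃ C : ℝ, 0 < C ∧ ∃ k : ℕ,
      ∀ G : RandomWalkBandit.Chain K,
        (∀ i, ∑ j, G.m i j ≤ ρ) →
        (∀ i j, i ≠ j → α ≤ G.visitProb i j) →
      ∀ adv : RandomWalkBandit.History K → RandomWalkBandit.Lengths K,
        (∀ h x y, 0 ≤ adv h x y ∧ adv h x y ≤ 1) →
      ∀ (T : ℕ) (ε : ℝ), 1 ≤ T → 0 < ε → ε < 1 →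
      ∀ θ : RandomWalkBandit.Params,
        K * T * ρ ^ θ.B / (1 - ρ) ≤ ε →
        0 < θ.β → θ.β ≤ c * Real.sqrt (Real.log (T / ε) / T) →
        0 ≤ θ.η → θ.η * Real.log (T / ε) ≤ c →
      ∀ i : Fin K,
        1 - C * ε * (1 + Real.log (T / ε)) ^ k ≤
          RandomWalkBandit.prob (RandomWalkBandit.gameLaw G θ adv T)
            {ω | θ.β *
                (RandomWalkBandit.sumEpochs
                    (fun h _ => (G.expHittingTime (adv h) i - θ.B) / θ.B) ω
                  - RandomWalkBandit.sumEpochs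
                    (fun h w => RandomWalkBandit.zHat θ adv h w i) ω)
                ≤ Real.log (T / ε ^ 2)} := by
  set b := Real.log (1 - ρ) / Real.log ρ with hb
  have hb0 : 0 < b := div_pos_of_neg_of_neg (Real.log_neg (by linarith) (by linarith))
    (Real.log_neg hρ0 hρ1)
  set a := min α 1 with ha
  have ha0 : 0 < a := lt_min hα one_pos
  have ha1 : a ≤ 1 := min_le_right _ _
  obtain ⟨hΛ, hV⟩ := lossBound_ge hρ0 hρ1 hb0
  obtain ⟨c, hc⟩ : ∃ c, c = 1 / smallness K a (lossBound ρ b) (lossVarBound ρ b) := ⟨_, rfl⟩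
  obtain ⟨hc0, -, -, hc3, -⟩ := mul_inv_smallness (K := K) ha0 (by linarith) hV hc
  refine ⟨c, hc0, 2 / ρ + 6 * K + 3, by positivity, 0, ?_⟩
  intro G hρ hvis adv hadv T ε hT hε hε1 θ hBε hβ hβc hη hηc i
  rw [pow_zero, mul_one]
  have hT' : (1 : ℝ) ≤ T := Nat.one_le_cast.2 hT
  have hK : (1 : ℝ) ≤ K := Nat.one_le_cast.2 (NeZero.pos K)
  -- For `ε` not small the claimed probability is not positive.
  rcases le_or_gt 1 ((2 / ρ + 6 * K + 3) * ε) with hbig | hsmall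
  · exact (sub_nonpos.2 hbig).trans ENNReal.toReal_nonneg
  have hℓ : 1 ≤ Real.log (T / ε) := by
    rw [Real.le_log_iff_exp_le (by positivity)]
    have h3 : 3 * ε ≤ 1 := by
      have : 0 ≤ (2 / ρ + 6 * K) * ε := by positivity
      linarith
    calc Real.exp 1 ≤ 3 := by linarith [Real.exp_one_lt_d9]
      _ ≤ T / ε := by rw [le_div_iff₀ hε]; linarith
  have hvis' : ∀ i j, a ≤ G.visitProb i j := fun i j => by
    by_cases hij : i = j
    · rw [hij, G.visitProb_self]; exact ha1
    · exact (min_le_left _ _).trans (hvis i j hij)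
  obtain ⟨-, hbB, hTB⟩ := shift_bounds hρ0 hρ1 hT hε1 hBε
  have hB : 0 < θ.B := hb0.trans_le hbB
  have hlog : Real.log (1 / ε) + Real.log (T / ε) = Real.log (T / ε ^ 2) := by
    rw [← Real.log_mul (by positivity) (by positivity)]
    congr 1
    field_simp
  refine one_sub_le_prob _ (by positivity) ?_
  have e1 := gameLaw_long_walk_le G θ adv hρ0 hρ hT hB.le hρ1 hTB
  have e2 := gameLaw_frequency_le G θ adv hT hε ha0 ha1 hvis' hℓ i
  have e3 := gameLaw_sumEpochs_ge G θ adv (lmean_exp_compensatedLoss_le_one G θ adv hρ0 hρ1 hρ hb0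
    hbB hadv ha0 hβ hc3 (Real.log (T / ε)) i) T (Real.log (1 / ε))
  rw [← Real.log_inv, one_div, inv_inv, Real.exp_log hε] at e3
  have e4 := gameLaw_length_ne G θ adv T
  have e5 := (MeasureTheory.measure_iUnion_fintype_le (gameLaw G θ adv T).toOuterMeasure _).trans
    (Finset.sum_le_sum fun j (_ : j ∈ Finset.univ) => e2 j)
  rw [Finset.sum_const, Finset.card_univ, Fintype.card_fin, nsmul_eq_mul,
    ← ENNReal.ofReal_natCast, ← ENNReal.ofReal_mul (by positivity)] at e5
  refine le_trans (MeasureTheory.measure_mono ?_) ((MeasureTheory.measure_union_le _ _).trans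
    ((add_le_add ((MeasureTheory.measure_union_le _ _).trans (add_le_add
    ((MeasureTheory.measure_union_le _ _).trans (add_le_add e1 e5)) e3)) e4.le).trans ?_))
  · intro ω hω
    contrapose! hω
    simp only [Set.mem_union, Set.mem_iUnion, Set.mem_ofPred_eq, not_or, not_exists, not_and,
      not_le, not_lt, not_not] at hω
    obtain ⟨⟨⟨h1, h2⟩, h3⟩, h4⟩ := hω
    rw [Set.notMem_compl_iff, Set.mem_ofPred_eq, ← hlog]
    refine regret_le_of_concentration G θ adv hρ0 hρ1 hρ hb0 hbB hadv ha0 ha1 hβ hvis' hℓ hc hT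
      hβc hη hηc ω h4 i h1 (fun j h hh hn => (h2 j h hh hn).1) (fun j h hh hn s hs =>
        (h2 j h hh hn).2 s hs) ?_
    simpa using h3.le
  · rw [add_zero, ← ENNReal.ofReal_add (by positivity) (by positivity),
      ← ENNReal.ofReal_add (by positivity) (by positivity)]
    refine ENNReal.ofReal_le_ofReal ?_
    have : 2 * (ε / ρ) + K * (6 * ε) + ε = (2 / ρ + 6 * K + 1) * ε := by ring
    rw [this]
    gcongr
    norm_num
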